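/- Let $n\ge 2$ be an integer, let $x_0\in(0,+\infty]$, and let $F:[0,x_0)\to(0,+\infty)$ be a decreasing continuous function, smooth on $(0,x_0)$. Let $$D_F=\{(z_0,z_1,\dots,z_{n-1})\in\mathbb C^n : |z_0|^2<x_0,\ \|z\|^2<F(|z_0|^2)\},\qquad \|z\|^2=|z_1|^2+\cdots+|z_{n-1}|^2,$$ be the associated Hartogs domain, let $\Phi_F(z)=-\log\left(F(|z_0|^2)-\|z\|^2\right)$, and assume that $\omega_F=\frac i2\partial\bar\partial\Phi_F$ is a Kähler form on $D_F$, i.e. $\Phi_F$ is smooth on $D_F$ and the matrix $\partial\bar\partial\Phi_F$ of its second derivatives $\partial^2\Phi_F/\partial z_\alpha\partial\bar z_\beta$ is positive definite at every point of $D_F$. For integers $k\ge 0$ and $m\ge 1$ put $$c_k(F^m)=\int_0^{x_0}t^kF(t)^mG(t)\,dt\in(0,+\infty],\qquad G(t)=-\left(\frac{tF'(t)}{F(t)}\right)',$$ and assume that there is a real number $\gamma$ such that for all integers $m\ge 1$ and all $t\in[0,x_0)$ $$\sum_{k=0}^\infty\frac{t^k}{c_k(F^m)}=(m-1+\gamma)F(t)^{-m},$$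 where $1/c_k(F^m)=0$ if $c_k(F^m)=+\infty$. For an integer $m\ge 1$ let $$\mathcal H_{m\Phi_F}=\Big\{f\in\mathrm{Hol}(D_F) : \int_{D_F}e^{-m\Phi_F}|f|^2\,\frac{\omega_F^n}{n!}<\infty\Big\},\qquad \frac{\omega_F^n}{n!}=\det(\partial\bar\partial\Phi_F)\,d\lambda,$$ where $\lambda$ is Lebesgue measure on $\mathbb C^n$, with the inner product of $L^2(D_F,e^{-m\Phi_F}\omega_F^n/n!)$. Then $\mathcal H_{m\Phi_F}\ne\{0\}$ if and only if $m>n$. Moreover, if $m>n$, then $\mathcal H_{m\Phi_F}$ has a countably infinite orthonormal basis, and for every orthonormal basis $\{f_j\}$ of $\mathcal H_{m\Phi_F}$ the reproducing kernel $K_{m\Phi_F}(z,z)=\sum_j|f_j(z)|^2$ is given, at every $z\in D_F$, by $$K_{m\Phi_F}(z,z)=\frac{(m-2)(m-3)\cdots(m-n)}{\pi^n\left(F(|z_0|^2)-\|z\|^2\right)^m}\left[m-1+(1-w)\gamma\right],\qquad w=\frac{\|z\|^2}{F(|z_0|^2)}.$$ -/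

import Mathlib

open MeasureTheory Set
open scoped ContDiff ComplexOrder

namespace Hartogs

noncomputable section

/-- The Wirtinger derivative `∂f/∂z_a = (∂f/∂x_a - i ∂f/∂y_a) / 2` at `z`. -/
def dz {n : ℕ} (a : Fin n) (f : (Fin n → ℂ) → ℂ) (z : Fin n → ℂ) : ℂ :=
  (fderiv ℝ f z (Pi.single a 1) - Complex.I * fderiv ℝ f z (Pi.single a Complex.I)) / 2

/-- The Wirtinger derivative `∂f/∂z̄_b = (∂f/∂x_b + i ∂f/∂y_b) / 2` at `z`. -/
def dzbar {n : ℕ} (b : Fin n) (f : (Fin n → ℂ) → ℂ) (z : Fin n → ℂ) : ℂ :=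
  (fderiv ℝ f z (Pi.single b 1) + Complex.I * fderiv ℝ f z (Pi.single b Complex.I)) / 2

/-- The complex Hessian `(∂²Φ/∂z_a ∂z̄_b)`, i.e. the coefficient matrix of
`ω = (i/2) ∂∂̄Φ = (i/2) ∑ Φ_{a b̄} dz_a ∧ dz̄_b`. -/
def complexHessian {n : ℕ} (Φ : (Fin n → ℂ) → ℝ) (z : Fin n → ℂ) : Matrix (Fin n) (Fin n) ℂ :=
  Matrix.of fun a b => dz a (fun w => dzbar b (fun u => (Φ u : ℂ)) w) z

/-- `(i/2) ∂∂̄Φ` is a Kähler form on the open set `M`: `Φ` is smooth on `M` and the form is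
positive at every point of `M` (closedness is automatic). -/
def IsKahlerPotentialOn {n : ℕ} (Φ : (Fin n → ℂ) → ℝ) (M : Set (Fin n → ℂ)) : Prop :=
  ContDiffOn ℝ ∞ Φ M ∧ ∀ z ∈ M, (complexHessian Φ z).PosDef

/-- The measure `e^{-mΦ} ω^n/n!` on `M`, where `ω = (i/2) ∂∂̄Φ`, so that
`ω^n/n! = det(∂∂̄Φ) ω₀^n/n!` and `ω₀^n/n!` is Lebesgue measure. The volume form is the one of `ω`, not of `mω`. -/
def weightedMeasure {n : ℕ} (M : Set (Fin n → ℂ)) (Φ : (Fin n → ℂ) → ℝ) (m : ℕ) : Measure M :=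
  ((volume : Measure (Fin n → ℂ)).comap ((↑) : M → Fin n → ℂ)).withDensity fun z =>
    ENNReal.ofReal (Real.exp (-(m * Φ z)) * (complexHessian Φ z).det.re)

/-- `f : M → ℂ` is holomorphic on the open set `M ⊆ ℂⁿ`. -/
def IsHolomorphic {n : ℕ} {M : Set (Fin n → ℂ)} (f : M → ℂ) : Prop :=
  ∃ g : (Fin n → ℂ) → ℂ, DifferentiableOn ℂ g M ∧ ∀ z : M, f z = g z

/-- The weighted space `H_{mΦ}` of holomorphic functions `f` on `M` with
`∫_M e^{-mΦ} |f|² ω^n/n! < ∞`. -/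
def weightedSpace {n : ℕ} (M : Set (Fin n → ℂ)) (Φ : (Fin n → ℂ) → ℝ) (m : ℕ) :
    Submodule ℂ (M → ℂ) where
  carrier := {f | IsHolomorphic f ∧ MemLp f 2 (weightedMeasure M Φ m)}
  zero_mem' := ⟨⟨0, differentiableOn_const 0, fun _ => rfl⟩, MemLp.zero⟩
  add_mem' := by
    rintro f₁ f₂ ⟨⟨g₁, h₁, e₁⟩, m₁⟩ ⟨⟨g₂, h₂, e₂⟩, m₂⟩
    exact ⟨⟨g₁ + g₂, h₁.add h₂, fun z => by simp [e₁, e₂]⟩, m₁.add m₂⟩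
  smul_mem' := by
    rintro c f ⟨⟨g, h, e⟩, hm⟩
    exact ⟨⟨c • g, h.const_smul c, fun z => by simp [e]⟩, hm.const_smul c⟩

/-- The class of `f ∈ H_{mΦ}` in `L²(M, e^{-mΦ} ω^n/n!)`, whose inner product is that of
`H_{mΦ}`. -/
def toL2 {n : ℕ} {M : Set (Fin n → ℂ)} {Φ : (Fin n → ℂ) → ℝ} {m : ℕ}
    (f : weightedSpace M Φ m) : Lp ℂ 2 (weightedMeasure M Φ m) :=
  MemLp.toLp (f : M → ℂ) f.2.2

/-- The family `f` is an orthonormal (Hilbert) basis of `H_{mΦ}`: it is orthonormal, and its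
linear span is dense in `H_{mΦ}`. -/
structure IsOrthonormalBasis {n : ℕ} {M : Set (Fin n → ℂ)} {Φ : (Fin n → ℂ) → ℝ} {m : ℕ}
    {ι : Type*} (f : ι → weightedSpace M Φ m) : Prop where
  orthonormal : Orthonormal ℂ fun j => toL2 (f j)
  dense : ∀ h : weightedSpace M Φ m,
    toL2 h ∈ (Submodule.span ℂ (range fun j => toL2 (f j))).topologicalClosure

/-- `‖z‖² = |z_1|² + ⋯ + |z_d|²` for `(z_0, z_1, …, z_d) ∈ ℂ^{d+1}`; the coordinate `z_0` is
left out. -/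
def tailSq {d : ℕ} (z : Fin (d + 1) → ℂ) : ℝ := ∑ i : Fin d, ‖z i.succ‖ ^ 2

/-- The Hartogs domain `D_F ⊆ ℂ^{d+1}`. -/
def domain (d : ℕ) (x₀ : EReal) (F : ℝ → ℝ) : Set (Fin (d + 1) → ℂ) :=
  {z | ((‖z 0‖ ^ 2 : ℝ) : EReal) < x₀ ∧ tailSq z < F (‖z 0‖ ^ 2)}

/-- `Φ_F(z) = -log (F(|z_0|²) - ‖z‖²)`. -/
def potential (d : ℕ) (F : ℝ → ℝ) (z : Fin (d + 1) → ℂ) : ℝ :=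
  -Real.log (F (‖z 0‖ ^ 2) - tailSq z)

/-- `G(t) = -(t F'(t) / F(t))'`. -/
def G (F : ℝ → ℝ) (t : ℝ) : ℝ := -deriv (fun s => s * deriv F s / F s) t

/-- `c_k(F^m) = ∫_0^{x₀} t^k F(t)^m G(t) dt`, a value in `[0, ∞]`. -/
def c (x₀ : EReal) (F : ℝ → ℝ) (k m : ℕ) : ENNReal :=
  ∫⁻ t in {t : ℝ | 0 < t ∧ (t : EReal) < x₀}, ENNReal.ofReal (t ^ k * F t ^ m * G F t)

/-- The condition `∑_k t^k / c_k(F^m) = (m - 1 + γ) F(t)^{-m}` for all `t ∈ [0, x₀)`, where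
`1 / c_k(F^m)` is `0` when the integral `c_k(F^m)` diverges. -/
def SumCondition (x₀ : EReal) (F : ℝ → ℝ) (γ : ℝ) (m : ℕ) : Prop :=
  ∀ t : ℝ, 0 ≤ t → (t : EReal) < x₀ →
    HasSum (fun k : ℕ => t ^ k * ((c x₀ F k m)⁻¹).toReal) (((m : ℝ) - 1 + γ) * (F t ^ m)⁻¹)

end

end Hartogs

namespace Hartogs

section Wirtinger

variable {n : ℕ}

lemma dz_congr {f g : (Fin n → ℂ) → ℂ} {z : Fin n → ℂ} (a : Fin n) (h : f =ᶠ[nhds z] g) :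
    dz a f z = dz a g z := by
  simp only [dz, h.fderiv_eq]

lemma dz_mul {f g : (Fin n → ℂ) → ℂ} {z : Fin n → ℂ} (a : Fin n)
    (hf : DifferentiableAt ℝ f z) (hg : DifferentiableAt ℝ g z) :
    dz a (fun w => f w * g w) z = dz a f z * g z + f z * dz a g z := by
  simp only [dz, fderiv_fun_mul hf hg]
  simp only [add_apply, smul_apply, smul_eq_mul]
  ring

lemma fderiv_ofReal_comp {r : (Fin n → ℂ) → ℝ} {z : Fin n → ℂ} {g : ℝ → ℝ} {g' : ℝ}
    (hr : DifferentiableAt ℝ r z) (hg : HasDerivAt g g' (r z)) :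
    fderiv ℝ (fun w => ((g (r w) : ℝ) : ℂ)) z = g' • fderiv ℝ (fun w => (r w : ℂ)) z := by
  have h1 : HasFDerivAt (fun w => ((g (r w) : ℝ) : ℂ))
      (Complex.ofRealCLM.comp (g' • fderiv ℝ r z)) z :=
    Complex.ofRealCLM.hasFDerivAt.comp z (hg.comp_hasFDerivAt z hr.hasFDerivAt)
  have h2 : HasFDerivAt (fun w => (r w : ℂ)) (Complex.ofRealCLM.comp (fderiv ℝ r z)) z :=
    Complex.ofRealCLM.hasFDerivAt.comp z hr.hasFDerivAt
  rw [h1.fderiv, h2.fderiv]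
  ext v
  simp

lemma dz_ofReal_comp {r : (Fin n → ℂ) → ℝ} {z : Fin n → ℂ} {g : ℝ → ℝ} {g' : ℝ} (a : Fin n)
    (hr : DifferentiableAt ℝ r z) (hg : HasDerivAt g g' (r z)) :
    dz a (fun w => ((g (r w) : ℝ) : ℂ)) z = g' * dz a (fun w => (r w : ℂ)) z := by
  simp only [dz, fderiv_ofReal_comp hr hg, smul_apply, Complex.real_smul]
  ring

lemma dzbar_ofReal_comp {r : (Fin n → ℂ) → ℝ} {z : Fin n → ℂ} {g : ℝ → ℝ} {g' : ℝ} (a : Fin n)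
    (hr : DifferentiableAt ℝ r z) (hg : HasDerivAt g g' (r z)) :
    dzbar a (fun w => ((g (r w) : ℝ) : ℂ)) z = g' * dzbar a (fun w => (r w : ℂ)) z := by
  simp only [dzbar, fderiv_ofReal_comp hr hg, smul_apply,
    Complex.real_smul]
  ring

lemma dz_coord (a b : Fin n) (z : Fin n → ℂ) :
    dz a (fun w => w b) z = if a = b then 1 else 0 := by
  have h : HasFDerivAt (fun w : Fin n → ℂ => w b)
      (ContinuousLinearMap.proj (R := ℝ) (φ := fun _ : Fin n => ℂ) b) z :=
    (ContinuousLinearMap.proj (R := ℝ) (φ := fun _ : Fin n => ℂ) b).hasFDerivAt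
  rw [dz, h.fderiv]
  simp only [ContinuousLinearMap.proj_apply]
  rcases eq_or_ne a b with rfl | hab
  · simp
  · simp [hab]

lemma hasFDerivAt_normSq_coord (b : Fin n) (z : Fin n → ℂ) :
    HasFDerivAt (fun w : Fin n → ℂ => ‖w b‖ ^ 2)
      (2 • (innerSL ℝ (z b)).comp
        (ContinuousLinearMap.proj (R := ℝ) (φ := fun _ : Fin n => ℂ) b)) z :=
  (ContinuousLinearMap.proj (R := ℝ) (φ := fun _ : Fin n => ℂ) b).hasFDerivAt.norm_sq

lemma differentiable_normSq_coord (b : Fin n) :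
    Differentiable ℝ (fun w : Fin n → ℂ => ‖w b‖ ^ 2) := fun z =>
  (hasFDerivAt_normSq_coord b z).differentiableAt

lemma fderiv_ofReal_normSq_coord (b : Fin n) (z v : Fin n → ℂ) :
    fderiv ℝ (fun w : Fin n → ℂ => ((‖w b‖ ^ 2 : ℝ) : ℂ)) z v =
      ((2 * inner ℝ (z b) (v b) : ℝ) : ℂ) := by
  have := (Complex.ofRealCLM.hasFDerivAt.comp z (hasFDerivAt_normSq_coord b z)).fderiv
  rw [show (fun w : Fin n → ℂ => ((‖w b‖ ^ 2 : ℝ) : ℂ)) =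
    Complex.ofRealCLM ∘ (fun w : Fin n → ℂ => ‖w b‖ ^ 2) from rfl, this]
  simp
  ring

lemma dz_normSq_coord (a b : Fin n) (z : Fin n → ℂ) :
    dz a (fun w => ((‖w b‖ ^ 2 : ℝ) : ℂ)) z = if a = b then star (z b) else 0 := by
  rw [dz, fderiv_ofReal_normSq_coord, fderiv_ofReal_normSq_coord]
  rcases eq_or_ne a b with rfl | hab
  · apply Complex.ext <;> simp [Complex.inner, neg_div]
  · simp [hab]

lemma dzbar_normSq_coord (a b : Fin n) (z : Fin n → ℂ) :
    dzbar a (fun w => ((‖w b‖ ^ 2 : ℝ) : ℂ)) z = if a = b then z b else 0 := by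
  rw [dzbar, fderiv_ofReal_normSq_coord, fderiv_ofReal_normSq_coord]
  rcases eq_or_ne a b with rfl | hab
  · apply Complex.ext <;> simp [Complex.inner]
  · simp [hab]

end Wirtinger

section Determinant

open Matrix

lemma det_diagonal_add_vecMulVec {ι : Type*} [Fintype ι] [DecidableEq ι] (D u v : ι → ℂ)
    (hD : ∀ i, D i ≠ 0) :
    (diagonal D + vecMulVec u v).det = (∏ i, D i) * (1 + ∑ i, u i * v i / D i) := by
  have : IsUnit (diagonal D).det := by
    rw [det_diagonal]; exact (Finset.prod_ne_zero_iff.2 fun i _ => hD i).isUnit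
  rw [vecMulVec_eq Unit, det_add_replicateCol_mul_replicateRow this, det_diagonal]
  congr 2
  have hinv : (diagonal D)⁻¹ = diagonal (fun i => (D i)⁻¹) := by
    apply inv_eq_left_inv
    rw [diagonal_mul_diagonal, ← diagonal_one]
    congr 1
    ext i
    exact inv_mul_cancel₀ (hD i)
  rw [hinv]
  simp only [det_unique, Matrix.add_apply, one_apply_eq, mul_apply, replicateRow_apply,
    replicateCol_apply, diagonal_apply, mul_ite, mul_zero, Finset.mem_univ,
    if_true, Finset.sum_ite_eq']
  congr 1
  refine Finset.sum_congr rfl fun i _ => ?_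
  ring

lemma det_diagonal_cons_add_vecMulVec {d : ℕ} (x : ℂ) (D : Fin d → ℂ) (u v : Fin (d + 1) → ℂ)
    (hD : ∀ i, D i ≠ 0) :
    (diagonal (Fin.cons x D : Fin (d + 1) → ℂ) + vecMulVec u v).det =
      (∏ i, D i) * (x + u 0 * v 0 + x * ∑ i : Fin d, u i.succ * v i.succ / D i) := by
  have key : (fun x : ℂ => (diagonal (Fin.cons x D : Fin (d + 1) → ℂ) + vecMulVec u v).det) =
      fun x => (∏ i, D i) * (x + u 0 * v 0 + x * ∑ i : Fin d, u i.succ * v i.succ / D i) := by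
    refine Continuous.ext_on (dense_compl_singleton (0 : ℂ)) ?_ (by fun_prop) ?_
    · refine Continuous.matrix_det ?_
      refine Continuous.add (Continuous.matrix_diagonal ?_) continuous_const
      refine continuous_pi fun i => ?_
      refine Fin.cases ?_ (fun i => ?_) i
      · exact continuous_id
      · exact continuous_const
    · intro x hx
      have hx : x ≠ 0 := hx
      simp only
      rw [det_diagonal_add_vecMulVec]
      · rw [Fin.prod_univ_succ, Fin.sum_univ_succ]
        simp only [Fin.cons_zero, Fin.cons_succ]
        field_simp
        ring
      · intro i
        refine Fin.cases ?_ (fun i => ?_) i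
        · simpa using hx
        · simpa using hD i
  exact congrFun key x

end Determinant

section Hessian

variable {d : ℕ}

/-- The value `F(|z_0|²) - ‖z‖²`, positive exactly on the Hartogs domain. -/
noncomputable def gap (F : ℝ → ℝ) (z : Fin (d + 1) → ℂ) : ℝ := F (‖z 0‖ ^ 2) - tailSq z

/-- Minus the derivative of `gap` with respect to `|z_b|²`. -/
noncomputable def gapSlope (F : ℝ → ℝ) (b : Fin (d + 1)) (z : Fin (d + 1) → ℂ) : ℝ :=
  Fin.cases (motive := fun _ => ℝ) (-deriv F (‖z 0‖ ^ 2)) (fun _ => 1) b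

variable {F : ℝ → ℝ} {z : Fin (d + 1) → ℂ}

lemma differentiable_tailSq : Differentiable ℝ (tailSq (d := d)) := by
  unfold tailSq
  exact Differentiable.fun_sum fun i _ => differentiable_normSq_coord _

lemma differentiableAt_gap (hF : DifferentiableAt ℝ F (‖z 0‖ ^ 2)) :
    DifferentiableAt ℝ (gap F) z :=
  (hF.comp z (differentiable_normSq_coord 0 z)).sub (differentiable_tailSq z)

lemma fderiv_ofReal_gap (hF : DifferentiableAt ℝ F (‖z 0‖ ^ 2)) :
    fderiv ℝ (fun w => (gap F w : ℂ)) z =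
      -∑ b : Fin (d + 1), gapSlope F b z • fderiv ℝ (fun w => ((‖w b‖ ^ 2 : ℝ) : ℂ)) z := by
  have h1 : ∀ b : Fin (d + 1), DifferentiableAt ℝ
      (fun w : Fin (d + 1) → ℂ => ((‖w b‖ ^ 2 : ℝ) : ℂ)) z := fun b =>
    Complex.ofRealCLM.differentiableAt.comp z (differentiable_normSq_coord b z)
  have h2 : DifferentiableAt ℝ (fun w : Fin (d + 1) → ℂ => ((F (‖w 0‖ ^ 2) : ℝ) : ℂ)) z :=
    Complex.ofRealCLM.differentiableAt.comp z (hF.comp z (differentiable_normSq_coord 0 z))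
  have e : (fun w : Fin (d + 1) → ℂ => (gap F w : ℂ)) =
      fun w => ((F (‖w 0‖ ^ 2) : ℝ) : ℂ) - ∑ i : Fin d, ((‖w i.succ‖ ^ 2 : ℝ) : ℂ) := by
    ext w; simp [gap, tailSq]
  rw [e, fderiv_fun_sub h2 (DifferentiableAt.fun_sum fun i _ => h1 _),
    fderiv_fun_sum fun i _ => h1 _,
    fderiv_ofReal_comp (differentiable_normSq_coord 0 z) hF.hasDerivAt, Fin.sum_univ_succ]
  simp only [gapSlope, Fin.cases_zero, Fin.cases_succ, one_smul]
  module

lemma dz_gap (hF : DifferentiableAt ℝ F (‖z 0‖ ^ 2)) (a : Fin (d + 1)) :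
    dz a (fun w => (gap F w : ℂ)) z = -(gapSlope F a z * star (z a)) := by
  have : dz a (fun w => (gap F w : ℂ)) z =
      -∑ b, gapSlope F b z * dz a (fun w => ((‖w b‖ ^ 2 : ℝ) : ℂ)) z := by
    simp only [dz, fderiv_ofReal_gap hF, neg_apply,
      sum_apply, smul_apply, Complex.real_smul,
      mul_div_assoc', mul_sub, sub_div, Finset.sum_sub_distrib, neg_div, neg_sub,
      ← Finset.sum_div, mul_neg, Finset.mul_sum]
    rw [sub_neg_eq_add, neg_add_eq_sub]
    congr 2
    exact Finset.sum_congr rfl fun b _ => by ring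
  rw [this]
  simp only [dz_normSq_coord]
  simp

lemma dzbar_gap (hF : DifferentiableAt ℝ F (‖z 0‖ ^ 2)) (a : Fin (d + 1)) :
    dzbar a (fun w => (gap F w : ℂ)) z = -(gapSlope F a z * z a) := by
  have : dzbar a (fun w => (gap F w : ℂ)) z =
      -∑ b, gapSlope F b z * dzbar a (fun w => ((‖w b‖ ^ 2 : ℝ) : ℂ)) z := by
    simp only [dzbar, fderiv_ofReal_gap hF, neg_apply,
      sum_apply, smul_apply, Complex.real_smul,
      mul_div_assoc', mul_add, add_div, Finset.sum_add_distrib, neg_div, neg_add,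
      ← Finset.sum_div, mul_neg, Finset.mul_sum]
    congr 3
    exact Finset.sum_congr rfl fun b _ => by ring
  rw [this]
  simp only [dzbar_normSq_coord]
  simp

lemma dzbar_potential (hF : DifferentiableAt ℝ F (‖z 0‖ ^ 2)) (hz : 0 < gap F z)
    (b : Fin (d + 1)) :
    dzbar b (fun u => (potential d F u : ℂ)) z =
      ((gapSlope F b z : ℝ) : ℂ) * ((((gap F z)⁻¹ : ℝ) : ℂ) * z b) := by
  have h := dzbar_ofReal_comp b (differentiableAt_gap hF) (Real.hasDerivAt_log hz.ne').neg
  have e : (fun u => (potential d F u : ℂ)) = fun w => (((-Real.log) (gap F w) : ℝ) : ℂ) := by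
    ext w; simp [potential, gap]
  rw [e, h, dzbar_gap hF]
  push_cast
  ring

lemma dz_gapSlope (hF : DifferentiableAt ℝ (deriv F) (‖z 0‖ ^ 2)) (a b : Fin (d + 1)) :
    dz a (fun w => ((gapSlope F b w : ℝ) : ℂ)) z =
      if a = 0 ∧ b = 0 then -((deriv (deriv F) (‖z 0‖ ^ 2) : ℝ) : ℂ) * star (z 0) else 0 := by
  refine Fin.cases ?_ (fun i => ?_) b
  · have := dz_ofReal_comp a (differentiable_normSq_coord 0 z) hF.hasDerivAt.neg
    simp only [gapSlope, Fin.cases_zero]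
    rw [show (fun w : Fin (d + 1) → ℂ => ((-deriv F (‖w 0‖ ^ 2) : ℝ) : ℂ)) =
      fun w => (((-deriv F) (‖w 0‖ ^ 2) : ℝ) : ℂ) from rfl, this, dz_normSq_coord]
    by_cases ha : a = 0 <;> simp [ha]
  · simp [gapSlope, dz]

lemma differentiableAt_gapSlope (hF : DifferentiableAt ℝ (deriv F) (‖z 0‖ ^ 2))
    (b : Fin (d + 1)) : DifferentiableAt ℝ (gapSlope F b) z := by
  refine Fin.cases ?_ (fun i => ?_) b
  · exact (hF.comp z (differentiable_normSq_coord 0 z)).neg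
  · exact differentiableAt_const (1 : ℝ)

lemma complexHessian_potential
    (hF : ∀ᶠ t in nhds (‖z 0‖ ^ 2), DifferentiableAt ℝ F t)
    (hF' : DifferentiableAt ℝ (deriv F) (‖z 0‖ ^ 2)) (hz : 0 < gap F z) :
    complexHessian (potential d F) z =
      Matrix.diagonal (Fin.cons
        ((-(deriv F (‖z 0‖ ^ 2) + ‖z 0‖ ^ 2 * deriv (deriv F) (‖z 0‖ ^ 2)) / gap F z : ℝ) : ℂ)
        fun _ => (((gap F z)⁻¹ : ℝ) : ℂ)) +
      Matrix.vecMulVec (fun a => gapSlope F a z * star (z a) / gap F z)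
        (fun b => gapSlope F b z * z b / gap F z) := by
  have hF0 : DifferentiableAt ℝ F (‖z 0‖ ^ 2) := hF.self_of_nhds
  have hgap := differentiableAt_gap hF0
  have hev : ∀ b : Fin (d + 1), (fun w => dzbar b (fun u => (potential d F u : ℂ)) w) =ᶠ[nhds z]
      fun w => ((gapSlope F b w : ℝ) : ℂ) * ((((gap F w)⁻¹ : ℝ) : ℂ) * w b) := by
    intro b
    have c1 : ContinuousAt (fun w : Fin (d + 1) → ℂ => ‖w 0‖ ^ 2) z :=
      (differentiable_normSq_coord 0 z).continuousAt
    filter_upwards [c1.eventually hF,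
      hgap.continuousAt.eventually (lt_mem_nhds hz)] with w h1 h2
    exact dzbar_potential h1 h2 b
  refine Matrix.ext fun a b => ?_
  rw [complexHessian, Matrix.of_apply, dz_congr a (hev b)]
  have d1 : DifferentiableAt ℝ (fun w => ((gapSlope F b w : ℝ) : ℂ)) z :=
    Complex.ofRealCLM.differentiableAt.comp z (differentiableAt_gapSlope hF' b)
  have d2 : DifferentiableAt ℝ (fun w => (((gap F w)⁻¹ : ℝ) : ℂ)) z :=
    Complex.ofRealCLM.differentiableAt.comp z (hgap.inv hz.ne')
  have d3 : DifferentiableAt ℝ (fun w : Fin (d + 1) → ℂ => w b) z :=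
    (ContinuousLinearMap.proj (R := ℝ) (φ := fun _ : Fin (d + 1) => ℂ) b).differentiableAt
  rw [dz_mul a d1 (d2.fun_mul d3), dz_mul a d2 d3, dz_coord, dz_gapSlope hF',
    dz_ofReal_comp a hgap (hasDerivAt_inv hz.ne'), dz_gap hF0]
  have hA : ((gap F z : ℝ) : ℂ) ≠ 0 := by exact_mod_cast hz.ne'
  have hn : star (z 0) * z 0 = ((‖z 0‖ ^ 2 : ℝ) : ℂ) := by
    rw [Complex.star_def, mul_comm, Complex.mul_conj, Complex.normSq_eq_norm_sq]
  rw [Matrix.add_apply, Matrix.vecMulVec_apply, Matrix.diagonal_apply]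
  revert b
  refine Fin.cases ?_ (fun i => ?_) <;> refine Fin.cases ?_ (fun j => ?_) a
  · intros
    simp only [and_self, if_true, gapSlope, Fin.cases_zero, Fin.cons_zero]
    push_cast
    push_cast at hn
    field_simp
    linear_combination (-deriv (deriv F) (‖z 0‖ ^ 2) * gap F z : ℂ) * hn
  · intros
    simp only [Fin.succ_ne_zero, false_and, if_false, gapSlope, Fin.cases_zero, Fin.cases_succ]
    push_cast
    field_simp
    ring
  · intros
    simp only [Fin.succ_ne_zero, and_false, if_false, gapSlope, Fin.cases_zero, Fin.cases_succ,
      (Fin.succ_ne_zero _).symm]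
    push_cast
    field_simp
    ring
  · intros
    simp only [Fin.succ_ne_zero, false_and, if_false, gapSlope, Fin.cases_succ, Fin.cons_succ]
    split_ifs <;> push_cast <;> field_simp <;> ring

lemma G_eq {t : ℝ} (hF : DifferentiableAt ℝ F t) (hF' : DifferentiableAt ℝ (deriv F) t)
    (h0 : F t ≠ 0) :
    G F t = -((deriv F t + t * deriv (deriv F) t) * F t - t * deriv F t ^ 2) / F t ^ 2 := by
  have := ((hasDerivAt_id t).mul hF'.hasDerivAt).div hF.hasDerivAt h0
  rw [G, show (fun s => s * deriv F s / F s) = (id * deriv F) / F from rfl, this.deriv]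
  simp only [Pi.mul_apply, id]
  ring

/-- The volume density of the Kähler form of a Hartogs domain. -/
theorem det_complexHessian_potential
    (hF : ∀ᶠ t in nhds (‖z 0‖ ^ 2), DifferentiableAt ℝ F t)
    (hF' : DifferentiableAt ℝ (deriv F) (‖z 0‖ ^ 2)) (hz : 0 < gap F z) (h0 : F (‖z 0‖ ^ 2) ≠ 0) :
    (complexHessian (potential d F) z).det =
      ((F (‖z 0‖ ^ 2) ^ 2 * G F (‖z 0‖ ^ 2) / gap F z ^ (d + 2) : ℝ) : ℂ) := by
  have hA : ((gap F z : ℝ) : ℂ) ≠ 0 := by exact_mod_cast hz.ne'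
  have hF0 : ((F (‖z 0‖ ^ 2) : ℝ) : ℂ) ≠ 0 := by exact_mod_cast h0
  have hn : ∀ i, star (z i) * z i = ((‖z i‖ ^ 2 : ℝ) : ℂ) := fun i => by
    rw [Complex.star_def, mul_comm, Complex.mul_conj, Complex.normSq_eq_norm_sq]
  have hsum : ∑ i : Fin d, star (z i.succ) * z i.succ =
      ((F (‖z 0‖ ^ 2) : ℝ) : ℂ) - (gap F z : ℂ) := by
    simp only [hn, gap, tailSq]; push_cast; ring
  rw [complexHessian_potential hF hF' hz, det_diagonal_cons_add_vecMulVec,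
    G_eq hF.self_of_nhds hF' h0]
  · simp only [gapSlope, Fin.cases_zero, Fin.cases_succ]
    have : ∀ i : Fin d, ((1 : ℝ) : ℂ) * star (z i.succ) / (gap F z : ℂ) *
        (((1 : ℝ) : ℂ) * z i.succ / (gap F z : ℂ)) / (((gap F z)⁻¹ : ℝ) : ℂ) =
        (star (z i.succ) * z i.succ) / (gap F z : ℂ) := fun i => by
      push_cast; field_simp
    simp only [this, ← Finset.sum_div, hsum]
    have h00 := hn 0
    simp only [Finset.prod_const, Finset.card_univ, Fintype.card_fin]
    push_cast at h00 ⊢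
    have : -((deriv F (‖z 0‖ ^ 2) : ℝ) : ℂ) * star (z 0) / gap F z *
        (-((deriv F (‖z 0‖ ^ 2) : ℝ) : ℂ) * z 0 / gap F z)
        = ((deriv F (‖z 0‖ ^ 2) : ℝ) : ℂ) ^ 2 * (‖z 0‖ : ℂ) ^ 2 / gap F z ^ 2 := by
      rw [← h00]; ring
    rw [this, pow_add, inv_pow]
    field_simp
    ring
  · intro i
    push_cast
    exact inv_ne_zero hA

end Hessian

end Hartogs

namespace Hartogs

section OneVariable

open AddCircle

lemma fourier_natCast_apply (j : ℕ) (x : UnitAddCircle) :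
    fourier (j : ℤ) x = (toCircle x : ℂ) ^ j := by
  rw [fourier_apply, natCast_zsmul, toCircle_nsmul, Circle.coe_pow]

lemma integral_fourier_mul_fourier (k j : ℤ) :
    ∫ x : UnitAddCircle, fourier (-k) x * fourier j x ∂haarAddCircle = if j = k then 1 else 0 := by
  have := congrFun (fourierCoeff_fourier (T := 1) j) k
  rw [fourierCoeff] at this
  simp only [smul_eq_mul] at this
  rw [this, Pi.single_apply]
  simp only [eq_comm]

lemma exists_integral_fourier_mul_comp_eq {f : ℂ → ℂ} {U : Set ℂ} (hU : IsOpen U)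
    (hf : DifferentiableOn ℂ f U) (hsub : Metric.closedBall 0 1 ⊆ U) :
    ∃ b : ℕ → ℂ, ∀ s : ℂ, ‖s‖ ≤ 1 → ∀ k : ℤ,
      ∫ x : UnitAddCircle, fourier (-k) x * f (s * toCircle x) ∂haarAddCircle =
        if 0 ≤ k then b k.toNat * s ^ k.toNat else 0 := by
  obtain ⟨δ, hδ, hsubδ⟩ := (isCompact_closedBall (0 : ℂ) 1).exists_cthickening_subset_open hU hsub
  rw [cthickening_closedBall hδ.le zero_le_one] at hsubδ
  let R : NNReal := ⟨δ + 1, by positivity⟩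
  have hR1 : 1 < R := by
    rw [← NNReal.coe_lt_coe]; change (1 : ℝ) < δ + 1; linarith
  have hps := (hf.mono hsubδ).hasFPowerSeriesOnBall (R := R) (zero_lt_one.trans hR1)
  set p := cauchyPowerSeries f 0 R
  refine ⟨p.coeff, fun s hs k => ?_⟩
  have hsumm : Summable fun j => ‖p.coeff j‖ := by
    have := p.summable_norm_mul_pow (r := 1)
      (lt_of_lt_of_le (by exact_mod_cast hR1) hps.r_le)
    simpa using this
  have hval : ∀ x : UnitAddCircle,
      HasSum (fun j => fourier (-k) x * (p.coeff j * s ^ j * fourier (j : ℤ) x))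
        (fourier (-k) x * f (s * toCircle x)) := by
    intro x
    have hy : s * toCircle x ∈ Metric.eball (0 : ℂ) R := by
      rw [Metric.mem_eball, edist_zero_right, ← ofReal_norm, norm_mul, Circle.norm_coe,
        mul_one, ← ENNReal.ofReal_coe_nnreal]
      exact (ENNReal.ofReal_lt_ofReal_iff (zero_lt_one.trans hR1)).2
        (lt_of_le_of_lt hs (by exact_mod_cast hR1))
    have h := (hps.hasSum hy).mul_left (fourier (-k) x)
    rw [zero_add] at h
    refine h.congr_fun fun j => ?_
    rw [FormalMultilinearSeries.apply_eq_pow_smul_coeff, fourier_natCast_apply, mul_pow,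
      smul_eq_mul]
    ring
  have hint : ∀ j : ℕ, Integrable (fun x : UnitAddCircle =>
      fourier (-k) x * (p.coeff j * s ^ j * fourier (j : ℤ) x)) haarAddCircle := fun j =>
    Continuous.integrable_of_hasCompactSupport (by fun_prop) (HasCompactSupport.of_compactSpace _)
  have hH := hasSum_integral_of_summable_integral_norm (μ := haarAddCircle) hint (by
    refine Summable.of_nonneg_of_le (fun j => integral_nonneg fun x => norm_nonneg _)
      (fun j => ?_) hsumm
    have : ∀ x : UnitAddCircle,
        ‖fourier (-k) x * (p.coeff j * s ^ j * fourier (j : ℤ) x)‖ ≤ ‖p.coeff j‖ := fun x => by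
      simp only [norm_mul, norm_pow, fourier_apply, Circle.norm_coe, one_mul, mul_one]
      exact mul_le_of_le_one_right (norm_nonneg _) (pow_le_one₀ (norm_nonneg _) hs)
    calc _ ≤ ∫ x : UnitAddCircle, ‖p.coeff j‖ ∂haarAddCircle :=
          integral_mono (hint j).norm (integrable_const _) this
      _ = _ := by simp)
  have hterm : ∀ j : ℕ, ∫ x : UnitAddCircle,
      fourier (-k) x * (p.coeff j * s ^ j * fourier (j : ℤ) x) ∂haarAddCircle =
        if (j : ℤ) = k then p.coeff j * s ^ j else 0 := fun j => by
    have : ∀ x : UnitAddCircle, fourier (-k) x * (p.coeff j * s ^ j * fourier (j : ℤ) x) =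
        p.coeff j * s ^ j * (fourier (-k) x * fourier (j : ℤ) x) := fun x => by ring
    simp only [this]
    rw [integral_const_mul, integral_fourier_mul_fourier]
    simp
  have e : ∫ x : UnitAddCircle, fourier (-k) x * f (s * toCircle x) ∂haarAddCircle =
      ∫ x : UnitAddCircle, ∑' j : ℕ, fourier (-k) x * (p.coeff j * s ^ j * fourier (j : ℤ) x)
        ∂haarAddCircle := integral_congr_ae (ae_of_all _ fun x => (hval x).tsum_eq.symm)
  rw [e, ← hH.tsum_eq]
  simp only [hterm]
  split_ifs with hk
  · rw [tsum_eq_single k.toNat]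
    · rw [if_pos (Int.toNat_of_nonneg hk)]
    · intro j hj
      rw [if_neg]
      rintro rfl
      simp at hj
  · have : ∀ j : ℕ, (j : ℤ) ≠ k := fun j hj => hk (hj ▸ Int.natCast_nonneg j)
    simp [this]

end OneVariable

section Torus

open AddCircle UnitAddTorus

variable {ι : Type*} [Fintype ι]

/-- The action of the torus on `ℂ^ι` by coordinatewise rotations. -/
noncomputable def torusRotate (x : ι → UnitAddCircle) (z : ι → ℂ) : ι → ℂ :=
  fun j => (toCircle (x j) : ℂ) * z j

/-- The normalized Haar measure of the torus. -/
noncomputable abbrev torusHaar (ι : Type*) [Fintype ι] : Measure (ι → UnitAddCircle) :=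
  Measure.pi fun _ => haarAddCircle

/-- The `ν`-th Fourier coefficient of `h` along the torus orbit of `z`. -/
noncomputable def torusCoeff (h : (ι → ℂ) → ℂ) (ν : ι → ℤ) (z : ι → ℂ) : ℂ :=
  ∫ x, mFourier (-ν) x * h (torusRotate x z) ∂torusHaar ι

/-- An open set of `ℂ^ι` that contains with `z` every point with smaller absolute values of
the coordinates. -/
structure IsCompleteReinhardt (D : Set (ι → ℂ)) : Prop where
  isOpen : IsOpen D
  mem_of_norm_le : ∀ z ∈ D, ∀ w : ι → ℂ, (∀ j, ‖w j‖ ≤ ‖z j‖) → w ∈ D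

omit [Fintype ι] in
@[simp] lemma norm_torusRotate (x : ι → UnitAddCircle) (z : ι → ℂ) (j : ι) :
    ‖torusRotate x z j‖ = ‖z j‖ := by simp [torusRotate, Circle.norm_coe]

omit [Fintype ι] in
lemma continuous_torusRotate (z : ι → ℂ) : Continuous fun x => torusRotate x z := by
  unfold torusRotate
  refine continuous_pi fun j => ?_
  exact (continuous_subtype_val.comp (continuous_toCircle.comp (continuous_apply j))).mul
    continuous_const

variable {D : Set (ι → ℂ)} {h : (ι → ℂ) → ℂ}

omit [Fintype ι] in
lemma IsCompleteReinhardt.torusRotate_mem (hD : IsCompleteReinhardt D) {z : ι → ℂ} (hz : z ∈ D)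
    (x : ι → UnitAddCircle) : torusRotate x z ∈ D :=
  hD.mem_of_norm_le z hz _ fun j => (norm_torusRotate x z j).le

omit [Fintype ι] in
lemma IsCompleteReinhardt.continuous_comp_torusRotate (hD : IsCompleteReinhardt D)
    (hh : DifferentiableOn ℂ h D) {z : ι → ℂ} (hz : z ∈ D) :
    Continuous fun x => h (torusRotate x z) :=
  hh.continuousOn.comp_continuous (continuous_torusRotate z) fun x => hD.torusRotate_mem hz x

variable [DecidableEq ι]

lemma mFourier_add_single (ν : ι → ℤ) (x : ι → UnitAddCircle) (j : ι) (φ : UnitAddCircle) :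
    mFourier ν (x + Pi.single j φ) = mFourier ν x * fourier (ν j) φ := by
  simp only [mFourier, ContinuousMap.coe_mk]
  rw [← Finset.mul_prod_erase _ _ (Finset.mem_univ j),
    ← Finset.mul_prod_erase _ (fun i => fourier (ν i) (x i)) (Finset.mem_univ j)]
  have : ∏ i ∈ Finset.univ.erase j, fourier (ν i) ((x + Pi.single j φ : ι → UnitAddCircle) i) =
      ∏ i ∈ Finset.univ.erase j, fourier (ν i) (x i) :=
    Finset.prod_congr rfl fun i hi => by
      simp [Pi.single_eq_of_ne (Finset.ne_of_mem_erase hi)]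
  rw [this]
  simp only [Pi.add_apply, Pi.single_eq_same, fourier_apply, smul_add, toCircle_add]
  push_cast
  ring

omit [Fintype ι] in
lemma torusRotate_add_single (x : ι → UnitAddCircle) (z : ι → ℂ) (j : ι) (φ : UnitAddCircle)
    (s : ℂ) : torusRotate (x + Pi.single j φ) (Function.update z j (s * z j)) =
      Function.update (torusRotate x z) j (s * toCircle φ * torusRotate x z j) := by
  ext i
  rcases eq_or_ne i j with rfl | hij
  · simp only [torusRotate, Pi.add_apply, Pi.single_eq_same, toCircle_add, Function.update_self]
    push_cast
    ring
  · simp [torusRotate, hij]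

omit [Fintype ι] in
lemma IsCompleteReinhardt.update_mem (hD : IsCompleteReinhardt D) {z : ι → ℂ} (hz : z ∈ D) (j : ι)
    {s : ℂ} (hs : ‖s‖ ≤ 1) : Function.update z j (s * z j) ∈ D := by
  refine hD.mem_of_norm_le z hz _ fun i => ?_
  rcases eq_or_ne i j with rfl | hij
  · rw [Function.update_self, norm_mul]
    exact mul_le_of_le_one_left (norm_nonneg _) hs
  · simp [hij]

lemma torusCoeff_update_eq_integral (hD : IsCompleteReinhardt D) (hh : DifferentiableOn ℂ h D)
    {z : ι → ℂ} (hz : z ∈ D) (ν : ι → ℤ) (j : ι) {s : ℂ} (hs : ‖s‖ ≤ 1) :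
    torusCoeff h ν (Function.update z j (s * z j)) =
      ∫ x, mFourier (-ν) x * ∫ φ : UnitAddCircle, fourier (-ν j) φ *
        h (Function.update (torusRotate x z) j (s * toCircle φ * torusRotate x z j))
          ∂haarAddCircle ∂torusHaar ι := by
  set z' := Function.update z j (s * z j)
  have hz' : z' ∈ D := hD.update_mem hz j hs
  let f : (ι → UnitAddCircle) → UnitAddCircle → ℂ := fun x φ =>
    mFourier (-ν) (x + Pi.single j φ) * h (torusRotate (x + Pi.single j φ) z')
  have hcont : Continuous (Function.uncurry f) := by
    have h1 : Continuous fun p : (ι → UnitAddCircle) × UnitAddCircle => p.1 + Pi.single j p.2 :=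
      continuous_fst.add ((continuous_single j).comp continuous_snd)
    exact ((mFourier (-ν)).continuous.comp h1).mul
      ((hD.continuous_comp_torusRotate hh hz').comp h1)
  have hint : Integrable (Function.uncurry f) ((torusHaar ι).prod haarAddCircle) :=
    hcont.integrable_of_hasCompactSupport (HasCompactSupport.of_compactSpace _)
  have h1 : ∀ φ : UnitAddCircle, torusCoeff h ν z' = ∫ x, f x φ ∂torusHaar ι := fun φ =>
    (integral_add_right_eq_self (μ := torusHaar ι)
      (fun x => mFourier (-ν) x * h (torusRotate x z')) (Pi.single j φ)).symm
  calc torusCoeff h ν z' = ∫ φ : UnitAddCircle, torusCoeff h ν z' ∂haarAddCircle := by simp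
    _ = ∫ φ : UnitAddCircle, ∫ x, f x φ ∂torusHaar ι ∂haarAddCircle := by simp only [← h1]
    _ = ∫ x, ∫ φ : UnitAddCircle, f x φ ∂haarAddCircle ∂torusHaar ι :=
      (integral_integral_swap hint).symm
    _ = _ := by
      congr 1
      ext x
      rw [← integral_const_mul]
      congr 1
      ext φ
      simp only [f, z', mFourier_add_single, torusRotate_add_single, Pi.neg_apply, mul_assoc]

lemma torusCoeff_update (hD : IsCompleteReinhardt D) (hh : DifferentiableOn ℂ h D)
    {z : ι → ℂ} (hz : z ∈ D) (ν : ι → ℤ) (j : ι) :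
    (0 ≤ ν j → ∀ s : ℂ, ‖s‖ ≤ 1 →
      torusCoeff h ν (Function.update z j (s * z j)) = s ^ (ν j).toNat * torusCoeff h ν z) ∧
    (ν j < 0 → torusCoeff h ν z = 0) := by
  have key : ∀ x : ι → UnitAddCircle, ∃ b : ℕ → ℂ, ∀ s : ℂ, ‖s‖ ≤ 1 → ∀ k : ℤ,
      ∫ φ : UnitAddCircle, fourier (-k) φ *
        h (Function.update (torusRotate x z) j (s * toCircle φ * torusRotate x z j))
          ∂haarAddCircle = if 0 ≤ k then b k.toNat * s ^ k.toNat else 0 := fun x => by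
    have hc : Differentiable ℂ
        fun ζ : ℂ => Function.update (torusRotate x z) j (ζ * torusRotate x z j) := by
      intro ζ
      rw [differentiableAt_pi]
      intro i
      rcases eq_or_ne i j with rfl | hij
      · simp
      · simp [hij]
    refine exists_integral_fourier_mul_comp_eq (hD.isOpen.preimage hc.continuous)
      (f := fun ζ => h (Function.update (torusRotate x z) j (ζ * torusRotate x z j)))
      (hh.comp hc.differentiableOn fun ζ hζ => hζ) fun ζ hζ => ?_
    exact hD.update_mem (hD.torusRotate_mem hz x) j (by simpa using hζ)
  choose b hb using key
  have h1 : torusCoeff h ν z = torusCoeff h ν (Function.update z j (1 * z j)) := by simp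
  constructor
  · intro hν s hs
    rw [h1, torusCoeff_update_eq_integral hD hh hz ν j hs,
      torusCoeff_update_eq_integral hD hh hz ν j (by simp : ‖(1 : ℂ)‖ ≤ 1), ← integral_const_mul]
    congr 1
    ext x
    rw [hb x s hs, hb x 1 (by simp), if_pos hν, if_pos hν]
    ring
  · intro hν
    rw [h1, torusCoeff_update_eq_integral hD hh hz ν j (by simp : ‖(1 : ℂ)‖ ≤ 1)]
    simp only [hb _ 1 (by simp : ‖(1 : ℂ)‖ ≤ 1), if_neg hν.not_ge, mul_zero, integral_zero]

lemma torusCoeff_mul (hD : IsCompleteReinhardt D) (hh : DifferentiableOn ℂ h D)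
    {z σ : ι → ℂ} (hz : z ∈ D) (hσ : ∀ j, ‖σ j‖ ≤ 1) (k : ι → ℕ) :
    torusCoeff h (fun j => (k j : ℤ)) (σ * z) =
      (∏ j, σ j ^ k j) * torusCoeff h (fun j => (k j : ℤ)) z := by
  have key : ∀ S : Finset ι, torusCoeff h (fun j => (k j : ℤ))
      (fun j => if j ∈ S then σ j * z j else z j) =
      (∏ j ∈ S, σ j ^ k j) * torusCoeff h (fun j => (k j : ℤ)) z := by
    intro S
    induction S using Finset.induction_on with
    | empty => simp
    | insert j S hj ih =>
      set zS : ι → ℂ := fun j => if j ∈ S then σ j * z j else z j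
      have hzS : zS ∈ D := hD.mem_of_norm_le z hz _ fun i => by
        by_cases hi : i ∈ S
        · simp only [zS, hi, if_true, norm_mul]
          exact mul_le_of_le_one_left (norm_nonneg _) (hσ i)
        · simp [zS, hi]
      have e : (fun i => if i ∈ insert j S then σ i * z i else z i) =
          Function.update zS j (σ j * zS j) := by
        ext i
        rcases eq_or_ne i j with rfl | hij
        · simp [zS, hj]
        · simp [zS, hij]
      rw [e, (torusCoeff_update hD hh hzS _ j).1 (by simp) _ (hσ j), ih, Finset.prod_insert hj]
      simp only [Int.toNat_natCast]
      ring
  simpa using! key Finset.univ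

omit [DecidableEq ι] in
lemma IsCompleteReinhardt.exists_mem_ne_zero (hD : IsCompleteReinhardt D) {z : ι → ℂ}
    (hz : z ∈ D) : ∃ w ∈ D, (∀ j, w j ≠ 0) ∧ ∃ σ : ι → ℂ, (∀ j, ‖σ j‖ ≤ 1) ∧ z = σ * w := by
  obtain ⟨r, hr, hball⟩ := Metric.isOpen_iff.1 hD.isOpen z hz
  refine ⟨fun j => if z j = 0 then ((r / 2 : ℝ) : ℂ) else z j, hball ?_, fun j => ?_,
    fun j => if z j = 0 then 0 else 1, fun j => ?_, ?_⟩
  · rw [Metric.mem_ball]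
    refine lt_of_le_of_lt ((dist_pi_le_iff (by positivity : (0 : ℝ) ≤ r / 2)).2 fun j => ?_)
      (half_lt_self hr)
    by_cases hj : z j = 0
    · simp [hj, abs_of_pos hr]
    · simp only [hj, if_false, dist_self]; positivity
  · by_cases hj : z j = 0
    · simp [hj, hr.ne']
    · simp [hj]
  · by_cases hj : z j = 0 <;> simp [hj]
  · ext j
    by_cases hj : z j = 0 <;> simp [hj]

/-- The Taylor coefficients of `h` at the origin, computed on the torus orbit of `w`. -/
noncomputable def taylorCoeff (w : ι → ℂ) (h : (ι → ℂ) → ℂ) (k : ι → ℕ) : ℂ :=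
  torusCoeff h (fun j => (k j : ℤ)) w / ∏ j, w j ^ k j

theorem torusCoeff_eq_taylorCoeff_mul (hD : IsCompleteReinhardt D) (hh : DifferentiableOn ℂ h D)
    {w : ι → ℂ} (hw : w ∈ D) (hw0 : ∀ j, w j ≠ 0) {z : ι → ℂ} (hz : z ∈ D) (k : ι → ℕ) :
    torusCoeff h (fun j => (k j : ℤ)) z = taylorCoeff w h k * ∏ j, z j ^ k j := by
  have main : ∀ z ∈ D, (∀ j, z j ≠ 0) →
      torusCoeff h (fun j => (k j : ℤ)) z = taylorCoeff w h k * ∏ j, z j ^ k j := by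
    intro z hz hz0
    let u : ι → ℂ := fun j => ((min ‖z j‖ ‖w j‖ : ℝ) : ℂ)
    have hu : ∀ j, ‖u j‖ = min ‖z j‖ ‖w j‖ := fun j => by
      simp [u, abs_of_nonneg (le_min (norm_nonneg (z j)) (norm_nonneg (w j)))]
    have hu0 : ∀ j, u j ≠ 0 := fun j => by
      rw [← norm_pos_iff, hu]
      exact lt_min (norm_pos_iff.2 (hz0 j)) (norm_pos_iff.2 (hw0 j))
    have e1 : u = (u / z) * z := by ext j; simp [hz0 j]
    have e2 : u = (u / w) * w := by ext j; simp [hw0 j]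
    have h1 : ∀ j, ‖(u / z) j‖ ≤ 1 := fun j => by
      rw [Pi.div_apply, norm_div, hu]
      exact div_le_one_of_le₀ (min_le_left _ _) (norm_nonneg _)
    have h2 : ∀ j, ‖(u / w) j‖ ≤ 1 := fun j => by
      rw [Pi.div_apply, norm_div, hu]
      exact div_le_one_of_le₀ (min_le_right _ _) (norm_nonneg _)
    have t1 := torusCoeff_mul hD hh hz h1 k
    have t2 := torusCoeff_mul hD hh hw h2 k
    rw [← e1] at t1
    rw [← e2, t1] at t2
    simp only [Pi.div_apply, div_pow, Finset.prod_div_distrib] at t2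
    have nz := Finset.prod_ne_zero_iff.2 fun j (_ : j ∈ Finset.univ) => pow_ne_zero (k j) (hz0 j)
    have nw := Finset.prod_ne_zero_iff.2 fun j (_ : j ∈ Finset.univ) => pow_ne_zero (k j) (hw0 j)
    have nu := Finset.prod_ne_zero_iff.2 fun j (_ : j ∈ Finset.univ) => pow_ne_zero (k j) (hu0 j)
    rw [taylorCoeff]
    field_simp at t2 ⊢
    linear_combination t2
  obtain ⟨z', hz', hz0', σ, hσ, rfl⟩ := hD.exists_mem_ne_zero hz
  rw [torusCoeff_mul hD hh hz' hσ, main z' hz' hz0']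
  simp only [Pi.mul_apply, mul_pow, Finset.prod_mul_distrib]
  ring

omit [DecidableEq ι] in
lemma torusCoeff_add {h' : (ι → ℂ) → ℂ} (hD : IsCompleteReinhardt D) (hh : DifferentiableOn ℂ h D)
    (hh' : DifferentiableOn ℂ h' D) {z : ι → ℂ} (hz : z ∈ D) (ν : ι → ℤ) :
    torusCoeff (h + h') ν z = torusCoeff h ν z + torusCoeff h' ν z := by
  have hi : ∀ g : (ι → ℂ) → ℂ, DifferentiableOn ℂ g D →
      Integrable (fun x => mFourier (-ν) x * g (torusRotate x z)) (torusHaar ι) := fun g hg =>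
    Continuous.integrable_of_hasCompactSupport
      ((mFourier (-ν)).continuous.mul (hD.continuous_comp_torusRotate hg hz))
      (HasCompactSupport.of_compactSpace _)
  simp only [torusCoeff]
  rw [← integral_add (hi h hh) (hi h' hh')]
  simp only [Pi.add_apply, mul_add]

omit [DecidableEq ι] in
lemma torusCoeff_smul (c : ℂ) (z : ι → ℂ) (ν : ι → ℤ) :
    torusCoeff (c • h) ν z = c * torusCoeff h ν z := by
  simp only [torusCoeff]
  rw [← integral_const_mul]
  simp only [Pi.smul_apply, smul_eq_mul, mul_left_comm]

lemma torusCoeff_eq_zero_of_notMem_range (hD : IsCompleteReinhardt D)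
    (hh : DifferentiableOn ℂ h D) {z : ι → ℂ} (hz : z ∈ D) (ν : ι → ℤ)
    (hν : ν ∉ range fun (k : ι → ℕ) j => (k j : ℤ)) : torusCoeff h ν z = 0 := by
  by_cases hj : ∃ j, ν j < 0
  · obtain ⟨j, hj⟩ := hj
    exact (torusCoeff_update hD hh hz ν j).2 hj
  · push Not at hj
    exact absurd ⟨fun j => (ν j).toNat, funext fun j => Int.toNat_of_nonneg (hj j)⟩ hν

omit [Fintype ι] [DecidableEq ι] in
lemma injective_natCast_pi : Function.Injective fun (k : ι → ℕ) (j : ι) => (k j : ℤ) :=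
  fun _ _ hkk => funext fun j => Nat.cast_injective (R := ℤ) (congrFun hkk j)

omit [DecidableEq ι] in
lemma hasSum_norm_sq_torusCoeff (hD : IsCompleteReinhardt D) (hh : DifferentiableOn ℂ h D)
    {z : ι → ℂ} (hz : z ∈ D) :
    HasSum (fun ν => ‖torusCoeff h ν z‖ ^ 2) (∫ x, ‖h (torusRotate x z)‖ ^ 2 ∂torusHaar ι) := by
  let f : C(ι → UnitAddCircle, ℂ) := ⟨_, hD.continuous_comp_torusRotate hh hz⟩
  have key := hasSum_sq_mFourierCoeff (ContinuousMap.toLp (E := ℂ) 2 (torusHaar ι) ℂ f)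
  have e : ∫ x, ‖ContinuousMap.toLp (E := ℂ) 2 (torusHaar ι) ℂ f x‖ ^ 2 ∂torusHaar ι =
      ∫ x, ‖h (torusRotate x z)‖ ^ 2 ∂torusHaar ι := by
    refine integral_congr_ae ?_
    filter_upwards [ContinuousMap.coeFn_toLp (p := 2) (𝕜 := ℂ) (torusHaar ι) f] with x hx
    rw [hx]; rfl
  rw [← e]
  refine key.congr_fun fun ν => ?_
  rw [show torusCoeff h ν z = mFourierCoeff f ν from rfl, ← mFourierCoeff_toLp]
  rfl

theorem hasSum_norm_sq_taylorCoeff (hD : IsCompleteReinhardt D) (hh : DifferentiableOn ℂ h D)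
    {w : ι → ℂ} (hw : w ∈ D) (hw0 : ∀ j, w j ≠ 0) {z : ι → ℂ} (hz : z ∈ D) :
    HasSum (fun k => ‖taylorCoeff w h k * ∏ j, z j ^ k j‖ ^ 2)
      (∫ x, ‖h (torusRotate x z)‖ ^ 2 ∂torusHaar ι) := by
  have := hasSum_norm_sq_torusCoeff hD hh hz
  rw [← injective_natCast_pi.hasSum_iff] at this
  · refine this.congr_fun fun k => ?_
    rw [Function.comp_apply, ← torusCoeff_eq_taylorCoeff_mul hD hh hw hw0 hz]
  · intro ν hν
    simp [torusCoeff_eq_zero_of_notMem_range hD hh hz ν hν]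

theorem hasSum_taylorCoeff (hD : IsCompleteReinhardt D) (hh : DifferentiableOn ℂ h D)
    {w : ι → ℂ} (hw : w ∈ D) (hw0 : ∀ j, w j ≠ 0) {z : ι → ℂ} (hz : z ∈ D)
    (hs : Summable fun k => taylorCoeff w h k * ∏ j, z j ^ k j) :
    HasSum (fun k => taylorCoeff w h k * ∏ j, z j ^ k j) (h z) := by
  let f : C(ι → UnitAddCircle, ℂ) := ⟨_, hD.continuous_comp_torusRotate hh hz⟩
  have hcoeff : ∀ ν, mFourierCoeff f ν = torusCoeff h ν z := fun ν => rfl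
  have h0 : ∀ ν ∉ range fun (k : ι → ℕ) j => (k j : ℤ), mFourierCoeff f ν = 0 := fun ν hν => by
    rw [hcoeff, torusCoeff_eq_zero_of_notMem_range hD hh hz ν hν]
  have hsum : Summable (mFourierCoeff f) := by
    rw [← injective_natCast_pi.summable_iff h0]
    refine hs.congr fun k => ?_
    rw [Function.comp_apply, hcoeff, torusCoeff_eq_taylorCoeff_mul hD hh hw hw0 hz]
  have key := hasSum_mFourier_series_apply_of_summable hsum 0
  have h0z : torusRotate 0 z = z := by ext j; simp [torusRotate]
  have hfz : f 0 = h z := by simp [f, h0z]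
  rw [hfz, ← injective_natCast_pi.hasSum_iff (fun ν hν => by simp [h0 ν hν])] at key
  refine key.congr_fun fun k => ?_
  rw [Function.comp_apply, hcoeff, torusCoeff_eq_taylorCoeff_mul hD hh hw hw0 hz]
  simp [mFourier]

end Torus

end Hartogs

namespace Hartogs

section TorusAverage

variable {ι : Type*} [Fintype ι]

lemma measurePreserving_torusRotate (x : ι → UnitAddCircle) :
    MeasurePreserving (torusRotate x) (volume : Measure (ι → ℂ)) volume :=
  volume_preserving_pi (f := fun j => rotation (AddCircle.toCircle (x j))) fun j =>
    (rotation (AddCircle.toCircle (x j))).measurePreserving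

omit [Fintype ι] in
lemma continuous_uncurry_torusRotate :
    Continuous fun p : (ι → UnitAddCircle) × (ι → ℂ) => torusRotate p.1 p.2 := by
  unfold torusRotate
  refine continuous_pi fun j => ?_
  exact (continuous_subtype_val.comp (AddCircle.continuous_toCircle.comp
    ((continuous_apply j).comp continuous_fst))).mul ((continuous_apply j).comp continuous_snd)

lemma lintegral_eq_lintegral_torus_average {g : (ι → ℂ) → ENNReal} (hg : Measurable g) :
    ∫⁻ z, g z = ∫⁻ z, ∫⁻ x, g (torusRotate x z) ∂torusHaar ι := by
  rw [lintegral_lintegral_swap]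
  · have : ∀ x : ι → UnitAddCircle, ∫⁻ z, g (torusRotate x z) = ∫⁻ z, g z := fun x =>
      (measurePreserving_torusRotate x).lintegral_comp hg
    simp [this]
  · exact (hg.comp (continuous_uncurry_torusRotate.measurable.comp measurable_swap)).aemeasurable

variable {D : Set (ι → ℂ)} {h : (ι → ℂ) → ℂ}

/-- Parseval's identity on a complete Reinhardt domain with a torus-invariant weight. -/
theorem setLIntegral_enorm_sq_eq_tsum (hD : IsCompleteReinhardt D) (hh : DifferentiableOn ℂ h D)
    {w : ι → ℂ} (hw : w ∈ D) (hw0 : ∀ j, w j ≠ 0) {ρ : (ι → ℂ) → ENNReal} (hρ : Measurable ρ)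
    (hinv : ∀ x z, ρ (torusRotate x z) = ρ z) :
    ∫⁻ z in D, ρ z * ‖h z‖ₑ ^ 2 =
      ∑' k : ι → ℕ, ‖taylorCoeff w h k‖ₑ ^ 2 * ∫⁻ z in D, ρ z * ‖∏ j, z j ^ k j‖ₑ ^ 2 := by
  classical
  have hDm := hD.isOpen.measurableSet
  have hmeas : Measurable (D.indicator fun z => ρ z * ‖h z‖ₑ ^ 2) := by
    have h1 : Measurable (D.indicator h) := by
      rw [← Set.piecewise_eq_indicator]
      exact hh.continuousOn.measurable_piecewise continuousOn_const hDm
    have h2 : D.indicator (fun z => ρ z * ‖h z‖ₑ ^ 2) =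
        D.indicator fun z => ρ z * ‖D.indicator h z‖ₑ ^ 2 := by
      ext z
      by_cases hz : z ∈ D <;> simp [hz]
    rw [h2]
    exact (hρ.mul (h1.enorm.pow_const 2)).indicator hDm
  have hmem : ∀ x z, torusRotate x z ∈ D ↔ z ∈ D := fun x z =>
    ⟨fun hz => hD.mem_of_norm_le _ hz _ fun j => (norm_torusRotate x z j).ge,
      fun hz => hD.torusRotate_mem hz x⟩
  have hav : ∀ z ∈ D, ∫⁻ x, ‖h (torusRotate x z)‖ₑ ^ 2 ∂torusHaar ι =
      ∑' k : ι → ℕ, ‖taylorCoeff w h k‖ₑ ^ 2 * ‖∏ j, z j ^ k j‖ₑ ^ 2 := by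
    intro z hz
    have hs := hasSum_norm_sq_taylorCoeff hD hh hw hw0 hz
    have hi : Integrable (fun x => ‖h (torusRotate x z)‖ ^ 2) (torusHaar ι) :=
      ((hD.continuous_comp_torusRotate hh hz).norm.pow 2).integrable_of_hasCompactSupport
        (HasCompactSupport.of_compactSpace _)
    have e1 : ∫⁻ x, ‖h (torusRotate x z)‖ₑ ^ 2 ∂torusHaar ι =
        ENNReal.ofReal (∫ x, ‖h (torusRotate x z)‖ ^ 2 ∂torusHaar ι) := by
      rw [ofReal_integral_eq_lintegral_ofReal hi (ae_of_all _ fun x => by positivity)]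
      simp only [ENNReal.ofReal_pow (norm_nonneg _), ofReal_norm]
    rw [e1, ← hs.tsum_eq, ENNReal.ofReal_tsum_of_nonneg (fun k => by positivity) hs.summable]
    refine tsum_congr fun k => ?_
    rw [ENNReal.ofReal_pow (norm_nonneg _), ofReal_norm, enorm_mul, mul_pow]
  calc ∫⁻ z in D, ρ z * ‖h z‖ₑ ^ 2
      = ∫⁻ z, D.indicator (fun z => ρ z * ‖h z‖ₑ ^ 2) z := (lintegral_indicator hDm _).symm
    _ = ∫⁻ z, ∫⁻ x, D.indicator (fun z => ρ z * ‖h z‖ₑ ^ 2) (torusRotate x z) ∂torusHaar ι :=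
      lintegral_eq_lintegral_torus_average hmeas
    _ = ∫⁻ z, D.indicator (fun z => ρ z *
          ∑' k : ι → ℕ, ‖taylorCoeff w h k‖ₑ ^ 2 * ‖∏ j, z j ^ k j‖ₑ ^ 2) z := by
      congr 1
      ext z
      by_cases hz : z ∈ D
      · simp only [indicator, hmem, hz, if_true, hinv]
        rw [lintegral_const_mul, hav z hz]
        exact (hD.continuous_comp_torusRotate hh hz).enorm.measurable.pow_const 2
      · simp [indicator, hmem, hz]
    _ = ∫⁻ z in D, ∑' k : ι → ℕ,
          ‖taylorCoeff w h k‖ₑ ^ 2 * (ρ z * ‖∏ j, z j ^ k j‖ₑ ^ 2) := by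
      rw [lintegral_indicator hDm]
      simp only [← ENNReal.tsum_mul_left, mul_left_comm]
    _ = _ := by
      have hm : ∀ k : ι → ℕ, Measurable fun z : ι → ℂ => ρ z * ‖∏ j, z j ^ k j‖ₑ ^ 2 := fun k =>
        hρ.mul (Continuous.measurable (by fun_prop))
      rw [lintegral_tsum fun k => ((hm k).const_mul _).aemeasurable]
      exact tsum_congr fun k => lintegral_const_mul _ (hm k)

end TorusAverage

section RadialMeasure

/-- The image of the Lebesgue measure of `ℂ` under `z ↦ |z|²`. -/
noncomputable def normSqMeasure : Measure ℝ := NNReal.pi • volume.restrict (Ioi 0)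

instance : SigmaFinite normSqMeasure := by
  unfold normSqMeasure; infer_instance

lemma lintegral_normSqMeasure (g : ℝ → ENNReal) :
    ∫⁻ t, g t ∂normSqMeasure = ENNReal.ofReal Real.pi * ∫⁻ t in Ioi 0, g t := by
  rw [normSqMeasure, lintegral_smul_measure]
  rw [ENNReal.smul_def, smul_eq_mul]
  congr 1
  rw [← NNReal.coe_real_pi, ENNReal.ofReal_coe_nnreal]

lemma lintegral_comp_normSq {g : ℝ → ENNReal} (hg : Measurable g) :
    ∫⁻ z : ℂ, g (‖z‖ ^ 2) = ENNReal.ofReal Real.pi * ∫⁻ t in Ioi 0, g t := by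
  have himg : (fun r : ℝ => r ^ 2) '' Ioi 0 = Ioi 0 := by
    ext t
    constructor
    · rintro ⟨r, hr, rfl⟩
      exact pow_pos (mem_Ioi.1 hr) 2
    · intro ht
      exact ⟨Real.sqrt t, Real.sqrt_pos.2 ht, Real.sq_sqrt (le_of_lt ht)⟩
  have hcv := lintegral_image_eq_lintegral_abs_deriv_mul (f := fun r : ℝ => r ^ 2)
    (f' := fun r => 2 * r) measurableSet_Ioi
    (fun r _ => by simpa using (hasDerivAt_pow 2 r).hasDerivWithinAt)
    (fun r hr s hs h => (pow_left_inj₀ (le_of_lt hr) (le_of_lt hs) two_ne_zero).1 h) g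
  rw [himg] at hcv
  rw [← Complex.lintegral_comp_polarCoord_symm, hcv]
  simp only [Complex.norm_polarCoord_symm, sq_abs, smul_eq_mul]
  rw [polarCoord_target, Measure.volume_eq_prod, ← Measure.prod_restrict,
    lintegral_prod _ (by fun_prop)]
  simp only [lintegral_const, Measure.restrict_apply MeasurableSet.univ, univ_inter,
    Real.volume_Ioo]
  rw [lintegral_mul_const _ (by fun_prop), mul_comm, ← lintegral_const_mul _ (by fun_prop),
    ← lintegral_const_mul _ (by fun_prop)]
  refine setLIntegral_congr_fun measurableSet_Ioi fun r hr => ?_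
  have hr : 0 < r := hr
  have hpi : 0 ≤ Real.pi - -Real.pi := by linarith [Real.pi_pos]
  simp only [abs_of_pos (mul_pos two_pos hr)]
  rw [← mul_assoc, ← mul_assoc, ← ENNReal.ofReal_mul hpi, ← ENNReal.ofReal_mul Real.pi_pos.le]
  congr 2
  ring

lemma map_normSq_volume : (volume : Measure ℂ).map (fun z => ‖z‖ ^ 2) = normSqMeasure := by
  ext s hs
  rw [← lintegral_indicator_one hs, ← lintegral_indicator_one hs, lintegral_normSqMeasure,
    lintegral_map (measurable_one.indicator hs) (by fun_prop),
    lintegral_comp_normSq (measurable_one.indicator hs)]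

lemma lintegral_comp_normSq_pi {n : ℕ} {g : (Fin n → ℝ) → ENNReal} (hg : Measurable g) :
    ∫⁻ z : Fin n → ℂ, g (fun j => ‖z j‖ ^ 2) = ∫⁻ y, g y ∂Measure.pi fun _ => normSqMeasure := by
  have hsf : ∀ i : Fin n, SigmaFinite ((volume : Measure ℂ).map (fun z => ‖z‖ ^ 2)) := fun i => by
    rw [map_normSq_volume]; infer_instance
  have := Measure.pi_map_pi (μ := fun _ : Fin n => (volume : Measure ℂ))
    (f := fun _ z => ‖z‖ ^ 2) (hμ := hsf) fun i => by fun_prop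
  simp only [map_normSq_volume] at this
  rw [← this, lintegral_map hg (by fun_prop)]
  rfl

lemma lintegral_pi_succ {d : ℕ} {g : (Fin (d + 1) → ℝ) → ENNReal} (hg : Measurable g) :
    ∫⁻ y, g y ∂Measure.pi (fun _ => normSqMeasure) =
      ∫⁻ t, ∫⁻ y, g (Fin.cons t y) ∂Measure.pi (fun _ : Fin d => normSqMeasure)
        ∂normSqMeasure := by
  have hmp := (measurePreserving_piFinSuccAbove (fun _ : Fin (d + 1) => normSqMeasure) 0).symm
  have hgm := (hg.comp hmp.measurable).aemeasurable
    (μ := normSqMeasure.prod (Measure.pi fun _ : Fin d => normSqMeasure))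
  rw [← hmp.lintegral_comp hg]
  refine (lintegral_prod _ hgm).trans ?_
  simp [MeasurableEquiv.piFinSuccAbove, Fin.insertNthEquiv]

end RadialMeasure

section Dirichlet

lemma intervalIntegral_pow_mul_sub_pow (X : ℝ) (a b : ℕ) :
    ∫ r in (0 : ℝ)..X, r ^ a * (X - r) ^ b =
      (a.factorial * b.factorial / (a + b + 1).factorial : ℝ) * X ^ (a + b + 1) := by
  induction b generalizing a with
  | zero =>
    simp only [pow_zero, mul_one, integral_pow, add_zero, Nat.factorial_zero, Nat.cast_one,
      Nat.factorial_succ]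
    have : (a.factorial : ℝ) ≠ 0 := by positivity
    push_cast
    field_simp
    simp
  | succ b ih =>
    have hderiv : ∀ r : ℝ, HasDerivAt (fun r => r ^ (a + 1) * (X - r) ^ (b + 1))
        ((a + 1) * (r ^ a * (X - r) ^ (b + 1)) - (b + 1) * (r ^ (a + 1) * (X - r) ^ b)) r := by
      intro r
      have h1 := hasDerivAt_pow (a + 1) r
      have h2 := ((hasDerivAt_id r).const_sub X).pow (b + 1)
      refine (h1.mul h2).congr_deriv ?_
      simp
      ring
    have hFTC := intervalIntegral.integral_eq_sub_of_hasDerivAt (a := 0) (b := X)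
      (fun r _ => hderiv r) (Continuous.intervalIntegrable (by fun_prop) _ _)
    rw [intervalIntegral.integral_sub (Continuous.intervalIntegrable (by fun_prop) _ _)
      (Continuous.intervalIntegrable (by fun_prop) _ _), intervalIntegral.integral_const_mul,
      intervalIntegral.integral_const_mul, ih (a + 1)] at hFTC
    simp only [sub_self, zero_pow (Nat.succ_ne_zero _), mul_zero, zero_mul] at hFTC
    have ha : ((a : ℝ) + 1) ≠ 0 := by positivity
    have e : a + (b + 1) + 1 = a + 1 + b + 1 := by ring
    rw [e]
    have : ((a : ℝ) + 1) * ∫ r in (0 : ℝ)..X, r ^ a * (X - r) ^ (b + 1) =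
      ((a : ℝ) + 1) * ((a.factorial * (b + 1).factorial / (a + 1 + b + 1).factorial : ℝ) *
        X ^ (a + 1 + b + 1)) := by
      rw [sub_eq_zero.1 hFTC, Nat.factorial_succ a, Nat.factorial_succ b]
      push_cast
      ring
    exact mul_left_cancel₀ ha this

lemma setLIntegral_pow_mul_sub_pow {X : ℝ} (hX : 0 < X) (a b : ℕ) :
    ∫⁻ r in Ioo 0 X, ENNReal.ofReal r ^ a * ENNReal.ofReal ((X - r) ^ b) =
      ENNReal.ofReal
        ((a.factorial * b.factorial / (a + b + 1).factorial : ℝ) * X ^ (a + b + 1)) := by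
  rw [← intervalIntegral_pow_mul_sub_pow, intervalIntegral.integral_of_le hX.le,
    ← restrict_Ioo_eq_restrict_Ioc, ofReal_integral_eq_lintegral_ofReal]
  · refine setLIntegral_congr_fun measurableSet_Ioo fun r hr => ?_
    rw [ENNReal.ofReal_mul (pow_nonneg hr.1.le _), ENNReal.ofReal_pow hr.1.le]
  · exact (Continuous.integrableOn_Icc (by fun_prop)).mono_set Ioo_subset_Icc_self
  · refine (ae_restrict_iff' measurableSet_Ioo).2 (ae_of_all _ fun r hr => ?_)
    exact mul_nonneg (pow_nonneg hr.1.le _) (pow_nonneg (sub_nonneg.2 hr.2.le) _)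

lemma setLIntegral_pow_mul_sub_zpow_eq_top {X : ℝ} (hX : 0 < X) (a : ℕ) {p : ℤ} (hp : p < 0) :
    ∫⁻ r in Ioo 0 X, ENNReal.ofReal r ^ a * ENNReal.ofReal ((X - r) ^ p) = ⊤ := by
  have hinv : ∫⁻ r in Ioo (X / 2) X, ENNReal.ofReal ((X - r)⁻¹) = ⊤ := by
    by_contra hne
    have hint : IntegrableOn (fun r : ℝ => (X - r)⁻¹) (Ioo (X / 2) X) := by
      refine ⟨(Measurable.aestronglyMeasurable (by fun_prop)), ?_⟩
      rw [hasFiniteIntegral_iff_ofReal]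
      · exact lt_top_iff_ne_top.2 hne
      · refine (ae_restrict_iff' measurableSet_Ioo).2 (ae_of_all _ fun r hr => ?_)
        exact inv_nonneg.2 (sub_nonneg.2 hr.2.le)
    have hint2 : IntervalIntegrable (fun r : ℝ => (r - X)⁻¹) volume (X / 2) X := by
      rw [intervalIntegrable_iff_integrableOn_Ioo_of_le (by linarith)]
      refine hint.neg.congr (ae_of_all _ fun r => ?_)
      simp only [Pi.neg_apply]
      rw [← inv_neg, neg_sub]
    rw [intervalIntegrable_sub_inv_iff] at hint2
    rcases hint2 with h | h
    · linarith
    · exact h right_mem_uIcc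
  set C : ℝ := (X / 2) ^ a * X ^ (p + 1)
  have hC : 0 < C := by positivity
  rw [eq_top_iff]
  calc (⊤ : ENNReal) = ENNReal.ofReal C * ∫⁻ r in Ioo (X / 2) X, ENNReal.ofReal ((X - r)⁻¹) := by
        rw [hinv, ENNReal.mul_top (by simpa using hC)]
    _ = ∫⁻ r in Ioo (X / 2) X, ENNReal.ofReal C * ENNReal.ofReal ((X - r)⁻¹) :=
      (lintegral_const_mul _ (by fun_prop)).symm
    _ ≤ ∫⁻ r in Ioo (X / 2) X, ENNReal.ofReal r ^ a * ENNReal.ofReal ((X - r) ^ p) := by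
      refine setLIntegral_mono' measurableSet_Ioo fun r hr => ?_
      have hr0 : 0 < r := lt_trans (by positivity) hr.1
      have hXr : 0 < X - r := sub_pos.2 hr.2
      rw [← ENNReal.ofReal_pow hr0.le, ← ENNReal.ofReal_mul hC.le,
        ← ENNReal.ofReal_mul (by positivity)]
      refine ENNReal.ofReal_le_ofReal ?_
      have h1 : (X / 2) ^ a ≤ r ^ a := pow_le_pow_left₀ (by positivity) hr.1.le a
      have h2 : X ^ (p + 1) ≤ (X - r) ^ (p + 1) := by
        obtain ⟨q, hq⟩ : ∃ q : ℕ, p + 1 = -(q : ℤ) := ⟨(-(p + 1)).toNat, by omega⟩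
        rw [hq, zpow_neg, zpow_neg, zpow_natCast, zpow_natCast]
        exact inv_anti₀ (by positivity) (pow_le_pow_left₀ hXr.le (by linarith) q)
      have h3 : (X - r) ^ p = (X - r) ^ (p + 1) * (X - r)⁻¹ := by
        rw [zpow_add_one₀ hXr.ne', mul_assoc, mul_inv_cancel₀ hXr.ne', mul_one]
      rw [h3, ← mul_assoc]
      exact mul_le_mul_of_nonneg_right (mul_le_mul h1 h2 (by positivity) (by positivity))
        (by positivity)
    _ ≤ _ := lintegral_mono_set (Ioo_subset_Ioo_left (by positivity))

/-- The integrand of the Dirichlet integral over the simplex `∑ y_i < X`. -/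
noncomputable def dirichletIntegrand {d : ℕ} (p : ℤ) (α : Fin d → ℕ) (X : ℝ) (y : Fin d → ℝ) :
    ENNReal :=
  if ∑ i, y i < X then
    (∏ i, ENNReal.ofReal (y i) ^ α i) * ENNReal.ofReal ((X - ∑ i, y i) ^ p) else 0

lemma measurable_uncurry_dirichletIntegrand {d : ℕ} (p : ℤ) (α : Fin d → ℕ) :
    Measurable fun q : ℝ × (Fin d → ℝ) => dirichletIntegrand p α q.1 q.2 := by
  unfold dirichletIntegrand
  refine Measurable.ite (measurableSet_lt (by fun_prop) (by fun_prop)) ?_ measurable_const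
  refine Measurable.mul (Finset.measurable_fun_prod _ fun i _ => by fun_prop) ?_
  exact ENNReal.measurable_ofReal.comp (Measurable.pow_const (by fun_prop) p)

lemma measurable_dirichletIntegrand {d : ℕ} (p : ℤ) (α : Fin d → ℕ) (X : ℝ) :
    Measurable (dirichletIntegrand p α X) :=
  (measurable_uncurry_dirichletIntegrand p α).comp measurable_prodMk_left

/-- The Dirichlet integral in the coordinates `|z_i|²`. -/
noncomputable def dirichletIntegral {d : ℕ} (p : ℤ) (α : Fin d → ℕ) (X : ℝ) : ENNReal :=
  ∫⁻ y, dirichletIntegrand p α X y ∂Measure.pi fun _ => normSqMeasure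

lemma dirichletIntegral_zero (p : ℤ) (α : Fin 0 → ℕ) (X : ℝ) :
    dirichletIntegral p α X = if 0 < X then ENNReal.ofReal (X ^ p) else 0 := by
  rw [dirichletIntegral, Measure.pi_of_empty _ (0 : Fin 0 → ℝ), lintegral_dirac]
  simp [dirichletIntegrand]

lemma dirichletIntegral_succ {d : ℕ} (p : ℤ) (α : Fin (d + 1) → ℕ) (X : ℝ) :
    dirichletIntegral p α X = ENNReal.ofReal Real.pi *
      ∫⁻ r in Ioi 0, ENNReal.ofReal r ^ α 0 *
        dirichletIntegral p (fun i => α i.succ) (X - r) := by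
  rw [dirichletIntegral, lintegral_pi_succ (measurable_dirichletIntegrand p α X),
    lintegral_normSqMeasure]
  congr 1
  refine lintegral_congr fun r => ?_
  rw [dirichletIntegral, ← lintegral_const_mul _ (measurable_dirichletIntegrand _ _ _)]
  refine lintegral_congr fun y => ?_
  simp only [dirichletIntegrand, Fin.sum_univ_succ, Fin.prod_univ_succ, Fin.cons_zero,
    Fin.cons_succ, lt_sub_iff_add_lt', mul_ite, mul_zero, ← sub_sub, mul_assoc]

lemma setLIntegral_Ioi_eq_Ioo {X : ℝ} {f : ℝ → ENNReal} (hf : ∀ r, X ≤ r → f r = 0) :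
    ∫⁻ r in Ioi 0, f r = ∫⁻ r in Ioo 0 X, f r := by
  rw [← lintegral_indicator measurableSet_Ioi, ← lintegral_indicator measurableSet_Ioo]
  congr 1
  ext r
  by_cases h : X ≤ r
  · simp [indicator, hf r h]
  · simp [indicator, not_le.1 h]

theorem dirichletIntegral_natCast {d : ℕ} (q : ℕ) (α : Fin d → ℕ) (X : ℝ) :
    dirichletIntegral (q : ℤ) α X = if 0 < X then ENNReal.ofReal
      (Real.pi ^ d * ((∏ i, (α i).factorial : ℕ) * q.factorial /
        (∑ i, α i + d + q).factorial : ℝ) * X ^ (∑ i, α i + d + q)) else 0 := by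
  induction d generalizing X with
  | zero =>
    have : (q.factorial : ℝ) ≠ 0 := by positivity
    rw [dirichletIntegral_zero]
    simp [this]
  | succ d ih =>
    rw [dirichletIntegral_succ]
    simp only [ih, sub_pos]
    rw [setLIntegral_Ioi_eq_Ioo (X := X) fun r hr => by simp [not_lt.2 hr]]
    split_ifs with hX
    · set s := ∑ i : Fin d, α i.succ
      set c : ℝ := Real.pi ^ d * ((∏ i : Fin d, (α i.succ).factorial : ℕ) * q.factorial /
        (s + d + q).factorial : ℝ)
      have hc : 0 ≤ c := by positivity
      have e : ∀ r ∈ Ioo 0 X, ENNReal.ofReal r ^ α 0 *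
          (if r < X then ENNReal.ofReal (c * (X - r) ^ (s + d + q)) else 0) =
          ENNReal.ofReal c *
            (ENNReal.ofReal r ^ α 0 * ENNReal.ofReal ((X - r) ^ (s + d + q))) := fun r hr => by
        rw [if_pos hr.2, ENNReal.ofReal_mul hc, mul_left_comm]
      rw [setLIntegral_congr_fun measurableSet_Ioo e, lintegral_const_mul _ (by fun_prop),
        setLIntegral_pow_mul_sub_pow hX, ← ENNReal.ofReal_mul hc,
        ← ENNReal.ofReal_mul Real.pi_pos.le]
      congr 1
      have e1 : ∑ i, α i + (d + 1) + q = α 0 + (s + d + q) + 1 := by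
        rw [Fin.sum_univ_succ]; ring
      rw [e1, Fin.prod_univ_succ]
      have : ((s + d + q).factorial : ℝ) ≠ 0 := by positivity
      simp only [c]
      push_cast
      field_simp
      ring
    · rw [Ioo_eq_empty (by simpa using hX)]
      simp

theorem dirichletIntegral_eq_top {d : ℕ} {p : ℤ} (hp : p < 0) (α : Fin (d + 1) → ℕ) {X : ℝ}
    (hX : 0 < X) : dirichletIntegral p α X = ⊤ := by
  have hpi : ENNReal.ofReal Real.pi ≠ 0 := by simpa using Real.pi_pos
  induction d generalizing X with
  | zero =>
    rw [dirichletIntegral_succ]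
    simp only [dirichletIntegral_zero, sub_pos]
    rw [setLIntegral_Ioi_eq_Ioo (X := X) fun r hr => by simp [not_lt.2 hr],
      setLIntegral_congr_fun (g := fun r => ENNReal.ofReal r ^ α 0 * ENNReal.ofReal ((X - r) ^ p))
        measurableSet_Ioo fun r hr => by simp only [if_pos hr.2],
      setLIntegral_pow_mul_sub_zpow_eq_top hX _ hp, ENNReal.mul_top hpi]
  | succ d ih =>
    rw [dirichletIntegral_succ]
    have : ∫⁻ r in Ioi 0, ENNReal.ofReal r ^ α 0 *
        dirichletIntegral p (fun i => α i.succ) (X - r) = ⊤ := by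
      rw [eq_top_iff]
      calc (⊤ : ENNReal) = ∫⁻ r in Ioo 0 X, ⊤ := by
            rw [setLIntegral_const, Real.volume_Ioo, ENNReal.top_mul (by simpa using hX)]
        _ ≤ ∫⁻ r in Ioo 0 X, ENNReal.ofReal r ^ α 0 *
              dirichletIntegral p (fun i => α i.succ) (X - r) := by
          refine setLIntegral_mono' measurableSet_Ioo fun r hr => ?_
          rw [ih _ (sub_pos.2 hr.2), ENNReal.mul_top]
          exact pow_ne_zero _ (by simpa using hr.1)
        _ ≤ _ := lintegral_mono_set Ioo_subset_Ioi_self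
    rw [this, ENNReal.mul_top hpi]

/-- Integration in the coordinates `|z_j|²` over a Hartogs domain. -/
theorem lintegral_hartogs_monomial {d : ℕ} {φ : ℝ → ENNReal} (hφ : Measurable φ) {f : ℝ → ℝ}
    (hf : Measurable f) (p : ℤ) (α : Fin d → ℕ) :
    ∫⁻ z : Fin (d + 1) → ℂ, φ (‖z 0‖ ^ 2) *
        dirichletIntegrand p α (f (‖z 0‖ ^ 2)) (fun i => ‖z i.succ‖ ^ 2) =
      ENNReal.ofReal Real.pi * ∫⁻ t in Ioi 0, φ t * dirichletIntegral p α (f t) := by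
  have hm : Measurable fun y : Fin (d + 1) → ℝ =>
      φ (y 0) * dirichletIntegrand p α (f (y 0)) (fun i => y i.succ) := by
    refine (hφ.comp (measurable_pi_apply 0)).mul ?_
    exact (measurable_uncurry_dirichletIntegrand p α).comp
      ((hf.comp (measurable_pi_apply 0)).prodMk
        (measurable_pi_lambda _ fun i => measurable_pi_apply _))
  rw [lintegral_comp_normSq_pi hm, lintegral_pi_succ hm, lintegral_normSqMeasure]
  congr 1
  refine lintegral_congr fun t => ?_
  simp only [Fin.cons_zero, Fin.cons_succ]
  rw [lintegral_const_mul _ (measurable_dirichletIntegrand _ _ _), dirichletIntegral]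

end Dirichlet

end Hartogs

namespace Hartogs

section Series

lemma sum_antidiagonal_pow_mul_inv_factorial (x y : ENNReal) (n : ℕ) :
    ∑ ij ∈ Finset.HasAntidiagonal.antidiagonal n, (x ^ ij.1 * (ij.1.factorial : ENNReal)⁻¹) *
      (y ^ ij.2 * (ij.2.factorial : ENNReal)⁻¹) = (x + y) ^ n * (n.factorial : ENNReal)⁻¹ := by
  rw [(Commute.all x y).add_pow', Finset.sum_mul]
  refine Finset.sum_congr rfl fun ij hij => ?_
  have hn : ij.1 + ij.2 = n := Finset.HasAntidiagonal.mem_antidiagonal.1 hij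
  have h0 : ∀ k : ℕ, (k.factorial : ENNReal) ≠ 0 := fun k => by
    exact_mod_cast k.factorial_ne_zero
  have ht : ∀ k : ℕ, (k.factorial : ENNReal) ≠ ⊤ := fun k => ENNReal.natCast_ne_top _
  have key : (n.choose ij.1 : ENNReal) * (n.factorial : ENNReal)⁻¹ =
      (ij.1.factorial : ENNReal)⁻¹ * (ij.2.factorial : ENNReal)⁻¹ := by
    have hc0 : (n.choose ij.1 : ENNReal) ≠ 0 := by
      exact_mod_cast (Nat.choose_pos (hn ▸ Nat.le_add_right _ _)).ne'
    have h := Nat.add_choose_mul_factorial_mul_factorial ij.1 ij.2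
    rw [← Nat.choose_symm_add, hn] at h
    rw [← h]
    push_cast
    rw [mul_assoc, ENNReal.mul_inv (Or.inl hc0) (Or.inl (ENNReal.natCast_ne_top _)), ← mul_assoc,
      ENNReal.mul_inv_cancel hc0 (ENNReal.natCast_ne_top _), one_mul,
      ENNReal.mul_inv (Or.inl (h0 _)) (Or.inl (ht _))]
  rw [nsmul_eq_mul]
  calc _ = x ^ ij.1 * y ^ ij.2 *
        ((ij.1.factorial : ENNReal)⁻¹ * (ij.2.factorial : ENNReal)⁻¹) := by ring
    _ = _ := by rw [← key]; ring

/-- Summation over multi-indices of functions of the total degree. -/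
theorem tsum_multiindex {d : ℕ} (y : Fin d → ENNReal) (φ : ℕ → ENNReal) :
    ∑' α : Fin d → ℕ, (∏ i, y i ^ α i) * (∏ i, ((α i).factorial : ENNReal)⁻¹) * φ (∑ i, α i) =
      ∑' a : ℕ, (∑ i, y i) ^ a * (a.factorial : ENNReal)⁻¹ * φ a := by
  induction d generalizing φ with
  | zero =>
    rw [tsum_eq_single (default : Fin 0 → ℕ) fun b hb => absurd (Subsingleton.elim _ _) hb,
      tsum_eq_single 0 fun b hb => by simp [hb]]
    simp
  | succ d ih =>
    rw [← (Fin.consEquiv fun _ : Fin (d + 1) => ℕ).tsum_eq, ENNReal.tsum_prod']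
    simp only [Fin.consEquiv, Equiv.coe_fn_mk, Fin.prod_univ_succ, Fin.sum_univ_succ,
      Fin.cons_zero, Fin.cons_succ]
    have h1 : ∀ a : ℕ, ∑' α : Fin d → ℕ, (y 0 ^ a * ∏ i : Fin d, y i.succ ^ α i) *
        ((a.factorial : ENNReal)⁻¹ * ∏ i : Fin d, ((α i).factorial : ENNReal)⁻¹) *
          φ (a + ∑ i, α i) = ∑' b : ℕ, (y 0 ^ a * (a.factorial : ENNReal)⁻¹) *
            ((∑ i : Fin d, y i.succ) ^ b * (b.factorial : ENNReal)⁻¹) * φ (a + b) := fun a => by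
      have h2 : ∀ α : Fin d → ℕ, (y 0 ^ a * ∏ i : Fin d, y i.succ ^ α i) *
        ((a.factorial : ENNReal)⁻¹ * ∏ i : Fin d, ((α i).factorial : ENNReal)⁻¹) *
          φ (a + ∑ i, α i) = (y 0 ^ a * (a.factorial : ENNReal)⁻¹) *
            ((∏ i : Fin d, y i.succ ^ α i) * (∏ i : Fin d, ((α i).factorial : ENNReal)⁻¹) *
              φ (a + ∑ i, α i)) := fun α => by ring
      simp only [h2, ENNReal.tsum_mul_left]
      rw [ih (fun i => y i.succ) fun b => φ (a + b), ← ENNReal.tsum_mul_left]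
      simp only [mul_assoc]
    have h3 := ENNReal.tsum_prod (f := fun a b : ℕ => (y 0 ^ a * (a.factorial : ENNReal)⁻¹) *
            ((∑ i : Fin d, y i.succ) ^ b * (b.factorial : ENNReal)⁻¹) * φ (a + b))
    refine (tsum_congr h1).trans (h3.symm.trans ?_)
    rw [← Finset.HasAntidiagonal.sigmaAntidiagonalEquivProd.tsum_eq, ENNReal.tsum_sigma']
    refine tsum_congr fun n => ?_
    rw [tsum_fintype, ← sum_antidiagonal_pow_mul_inv_factorial, Finset.sum_mul]
    refine (Finset.sum_coe_sort (Finset.HasAntidiagonal.antidiagonal n) fun ij : ℕ × ℕ =>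
      y 0 ^ ij.1 * (ij.1.factorial : ENNReal)⁻¹ * ((∑ i : Fin d, y i.succ) ^ ij.2 *
        (ij.2.factorial : ENNReal)⁻¹) * φ (ij.1 + ij.2)).trans ?_
    refine Finset.sum_congr rfl fun ij hij => ?_
    rw [Finset.HasAntidiagonal.mem_antidiagonal.1 hij]

lemma hasSum_factorial_div_mul_pow {w : ℝ} (hw : ‖w‖ < 1) (M : ℕ) :
    HasSum (fun a : ℕ => ((a + M).factorial / a.factorial : ℝ) * w ^ a)
      (M.factorial / (1 - w) ^ (M + 1)) := by
  have := (hasSum_choose_mul_geometric_of_norm_lt_one M hw).mul_left (M.factorial : ℝ)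
  rw [mul_one_div] at this
  refine this.congr_fun fun a => ?_
  have h := Nat.add_choose_mul_factorial_mul_factorial a M
  have ha : (a.factorial : ℝ) ≠ 0 := by positivity
  rw [← h, ← Nat.choose_symm_add]
  push_cast
  field_simp

lemma hasSum_kernel_series {w : ℝ} (hw : ‖w‖ < 1) (M : ℕ) (γ : ℝ) :
    HasSum (fun a : ℕ => ((a + M).factorial / a.factorial : ℝ) * (M + 1 + a + γ) * w ^ a)
      (M.factorial / (1 - w) ^ (M + 2) * (M + 1 + (1 - w) * γ)) := by
  have h1 := hasSum_factorial_div_mul_pow hw (M + 1)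
  have h2 := (hasSum_factorial_div_mul_pow hw M).mul_left γ
  have hw1 : 1 - w ≠ 0 := by
    have := (abs_lt.1 hw).2
    linarith
  convert h1.add h2 using 1
  · ext a
    rw [← add_assoc, Nat.factorial_succ]
    push_cast
    ring
  · rw [Nat.factorial_succ]
    push_cast
    field_simp
    ring

lemma prod_Icc_sub_mul_factorial (d q : ℕ) :
    (∏ l ∈ Finset.Icc 2 (d + 1), (((q + d + 2 : ℕ) : ℝ) - l)) * q.factorial =
      (q + d).factorial := by
  induction d generalizing q with
  | zero => simp
  | succ d ih =>
    rw [Finset.prod_Icc_succ_top (by omega)]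
    have h := ih (q + 1)
    rw [show q + 1 + d + 2 = q + (d + 1) + 2 by ring, show q + 1 + d = q + (d + 1) by ring,
      Nat.factorial_succ] at h
    rw [← h]
    push_cast
    ring

end Series

section Profile

/-- The interior `(0, x₀)` of the interval of definition of a Hartogs profile. -/
def openInterval (x₀ : EReal) : Set ℝ := {t : ℝ | 0 < t ∧ (t : EReal) < x₀}

/-- `F` is a positive decreasing function on `[0, x₀)`, smooth on `(0, x₀)`, whose Hartogs
potential is a Kähler potential. -/
structure IsKahlerProfile (d : ℕ) (x₀ : EReal) (F : ℝ → ℝ) : Prop where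
  x₀_pos : 0 < x₀
  pos : ∀ t : ℝ, 0 ≤ t → (t : EReal) < x₀ → 0 < F t
  anti : AntitoneOn F {t : ℝ | 0 ≤ t ∧ (t : EReal) < x₀}
  cont : ContinuousOn F {t : ℝ | 0 ≤ t ∧ (t : EReal) < x₀}
  smooth : ContDiffOn ℝ ∞ F {t : ℝ | 0 < t ∧ (t : EReal) < x₀}
  kahler : IsKahlerPotentialOn (potential d F) (domain d x₀ F)

variable {d : ℕ} {x₀ : EReal} {F : ℝ → ℝ}

lemma isOpen_openInterval (x₀ : EReal) : IsOpen (openInterval x₀) :=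
  (isOpen_lt continuous_const continuous_id).inter
    (isOpen_lt continuous_coe_real_ereal continuous_const)

lemma openInterval_nonempty (hx : 0 < x₀) : (openInterval x₀).Nonempty := by
  obtain ⟨t, ht0, htx⟩ := EReal.exists_between_coe_real hx
  exact ⟨t, by exact_mod_cast ht0, htx⟩

namespace IsKahlerProfile

variable (hF : IsKahlerProfile d x₀ F)
include hF

lemma isCompleteReinhardt : IsCompleteReinhardt (domain d x₀ F) where
  isOpen := by
    have hU : IsOpen {z : Fin (d + 1) → ℂ | ((‖z 0‖ ^ 2 : ℝ) : EReal) < x₀} :=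
      isOpen_lt (continuous_coe_real_ereal.comp (by fun_prop)) continuous_const
    have hc : ContinuousOn (gap F) {z : Fin (d + 1) → ℂ | ((‖z 0‖ ^ 2 : ℝ) : EReal) < x₀} :=
      (hF.cont.comp (Continuous.continuousOn (by fun_prop))
        fun z hz => ⟨by positivity, hz⟩).sub differentiable_tailSq.continuous.continuousOn
    have := hc.isOpen_inter_preimage hU (isOpen_Ioi (a := (0 : ℝ)))
    convert this using 1
    ext z
    simp [domain, gap]
  mem_of_norm_le := by
    rintro z ⟨hz1, hz2⟩ w hw
    have h0 : ‖w 0‖ ^ 2 ≤ ‖z 0‖ ^ 2 := pow_le_pow_left₀ (norm_nonneg _) (hw 0) 2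
    have h1 : ((‖w 0‖ ^ 2 : ℝ) : EReal) < x₀ := lt_of_le_of_lt (by exact_mod_cast h0) hz1
    refine ⟨h1, ?_⟩
    calc tailSq w ≤ tailSq z :=
          Finset.sum_le_sum fun i _ => pow_le_pow_left₀ (norm_nonneg _) (hw _) 2
      _ < F (‖z 0‖ ^ 2) := hz2
      _ ≤ F (‖w 0‖ ^ 2) := hF.anti ⟨by positivity, h1⟩ ⟨by positivity, hz1⟩ h0

lemma exists_mem_domain_ne_zero : ∃ w ∈ domain d x₀ F, ∀ j, w j ≠ 0 := by
  have h0 : (0 : Fin (d + 1) → ℂ) ∈ domain d x₀ F := by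
    refine ⟨by simpa using hF.x₀_pos, ?_⟩
    simpa [tailSq] using hF.pos 0 le_rfl (by simpa using hF.x₀_pos)
  obtain ⟨w, hw, hw0, -⟩ := hF.isCompleteReinhardt.exists_mem_ne_zero h0
  exact ⟨w, hw, hw0⟩

lemma det_complexHessian {z : Fin (d + 1) → ℂ} (hz : z ∈ domain d x₀ F) (hz0 : z 0 ≠ 0) :
    (complexHessian (potential d F) z).det =
      ((F (‖z 0‖ ^ 2) ^ 2 * G F (‖z 0‖ ^ 2) / gap F z ^ (d + 2) : ℝ) : ℂ) := by
  have ht : ‖z 0‖ ^ 2 ∈ openInterval x₀ := ⟨by positivity, hz.1⟩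
  have ho := (isOpen_openInterval x₀).mem_nhds ht
  have hd : DifferentiableOn ℝ F (openInterval x₀) := hF.smooth.differentiableOn (by simp)
  have hd' : DifferentiableOn ℝ (deriv F) (openInterval x₀) :=
    (hF.smooth.deriv_of_isOpen (m := 1) (isOpen_openInterval x₀)
      (by norm_cast)).differentiableOn (by simp)
  refine det_complexHessian_potential ?_ (hd'.differentiableAt ho) (sub_pos.2 hz.2)
    (hF.pos _ (by positivity) hz.1).ne'
  filter_upwards [ho] with t ht'
  exact hd.differentiableAt ((isOpen_openInterval x₀).mem_nhds ht')

lemma G_pos {t : ℝ} (ht : t ∈ openInterval x₀) : 0 < G F t := by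
  have hFt := hF.pos t ht.1.le ht.2
  set z : Fin (d + 1) → ℂ := Pi.single 0 ((Real.sqrt t : ℝ) : ℂ)
  have hn : ‖z 0‖ ^ 2 = t := by
    simp [z, Real.sq_sqrt ht.1.le]
  have htail : tailSq z = 0 := by simp [tailSq, z]
  have hz0 : z 0 ≠ 0 := fun h => by
    rw [h] at hn
    simp at hn
    exact ht.1.ne hn
  have hz : z ∈ domain d x₀ F := ⟨by rw [hn]; exact ht.2, by rw [hn, htail]; exact hFt⟩
  have hpos := (hF.kahler.2 z hz).det_pos
  rw [hF.det_complexHessian hz hz0, hn] at hpos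
  have hpos' : 0 < F t ^ 2 * G F t / gap F z ^ (d + 2) := by exact_mod_cast hpos
  have hgap : 0 < gap F z := sub_pos.2 hz.2
  rw [div_pos_iff_of_pos_right (by positivity)] at hpos'
  exact pos_of_mul_pos_right hpos' (by positivity)

omit hF in
lemma measurable_G (F : ℝ → ℝ) : Measurable (G F) := (measurable_deriv _).neg

lemma measurable_indicator : Measurable ((openInterval x₀).indicator F) := by
  classical
  rw [← Set.piecewise_eq_indicator]
  exact ContinuousOn.measurable_piecewise (hF.smooth.continuousOn) continuousOn_const
    (isOpen_openInterval x₀).measurableSet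

end IsKahlerProfile

/-- The density `e^{-mΦ} det(∂∂̄Φ)` of a Hartogs domain, with `p = m - n - 1`, in terms of the
absolute values of the coordinates. -/
noncomputable def hartogsWeight (x₀ : EReal) (F : ℝ → ℝ) (p : ℤ) (z : Fin (d + 1) → ℂ) : ENNReal :=
  (openInterval x₀).indicator (fun t => ENNReal.ofReal (F t ^ 2 * G F t)) (‖z 0‖ ^ 2) *
    dirichletIntegrand p 0 ((openInterval x₀).indicator F (‖z 0‖ ^ 2)) fun i => ‖z i.succ‖ ^ 2

lemma hartogsWeight_torusRotate (p : ℤ) (x : Fin (d + 1) → UnitAddCircle) (z : Fin (d + 1) → ℂ) :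
    hartogsWeight x₀ F p (torusRotate x z) = hartogsWeight x₀ F p z := by
  simp only [hartogsWeight, norm_torusRotate]

/-- The square of the weighted norm of the monomial `z^ν`. -/
noncomputable def monomialNormSq (d : ℕ) (x₀ : EReal) (F : ℝ → ℝ) (p : ℤ) (ν : Fin (d + 1) → ℕ) :
    ENNReal :=
  ∫⁻ z in domain d x₀ F, hartogsWeight x₀ F p z * ‖∏ j, z j ^ ν j‖ₑ ^ 2

namespace IsKahlerProfile

variable (hF : IsKahlerProfile d x₀ F)
include hF

lemma measurable_indicator_density :
    Measurable ((openInterval x₀).indicator fun t => ENNReal.ofReal (F t ^ 2 * G F t)) := by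
  have : ((openInterval x₀).indicator fun t => ENNReal.ofReal (F t ^ 2 * G F t)) =
      (openInterval x₀).indicator fun t =>
        ENNReal.ofReal ((openInterval x₀).indicator F t ^ 2 * G F t) := by
    ext t
    by_cases ht : t ∈ openInterval x₀ <;> simp [ht]
  rw [this]
  exact (((hF.measurable_indicator.pow_const 2).mul (measurable_G F)).ennreal_ofReal).indicator
    (isOpen_openInterval x₀).measurableSet

lemma measurable_hartogsWeight (p : ℤ) :
    Measurable (hartogsWeight (d := d) x₀ F p) := by
  have h0 : Measurable fun z : Fin (d + 1) → ℂ => ‖z 0‖ ^ 2 := by fun_prop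
  refine (hF.measurable_indicator_density.comp h0).mul ?_
  exact (measurable_uncurry_dirichletIntegrand p 0).comp
    ((hF.measurable_indicator.comp h0).prodMk (measurable_pi_lambda _ fun i => by fun_prop))

lemma ofReal_exp_mul_det_eq_hartogsWeight (m : ℕ) {z : Fin (d + 1) → ℂ}
    (hz : z ∈ domain d x₀ F) (hz0 : z 0 ≠ 0) :
    ENNReal.ofReal (Real.exp (-(m * potential d F z)) *
      (complexHessian (potential d F) z).det.re) = hartogsWeight x₀ F ((m : ℤ) - (d + 2)) z := by
  have ht : ‖z 0‖ ^ 2 ∈ openInterval x₀ := ⟨by positivity, hz.1⟩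
  have hgap : 0 < gap F z := sub_pos.2 hz.2
  have hG := hF.G_pos ht
  have htail : ∑ i : Fin d, ‖z i.succ‖ ^ 2 = tailSq z := rfl
  rw [hF.det_complexHessian hz hz0, Complex.ofReal_re, hartogsWeight, indicator_of_mem ht,
    indicator_of_mem ht, dirichletIntegrand, htail, if_pos hz.2]
  simp only [Pi.zero_apply, pow_zero, Finset.prod_const_one, one_mul]
  rw [← ENNReal.ofReal_mul (by positivity)]
  congr 1
  have h1 : Real.exp (-(m * potential d F z)) = gap F z ^ m := by
    change Real.exp (-(m * -Real.log (gap F z))) = _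
    rw [mul_neg, neg_neg, mul_comm, Real.exp_mul, Real.exp_log hgap, Real.rpow_natCast]
  rw [h1, zpow_sub₀ (show F (‖z 0‖ ^ 2) - tailSq z ≠ 0 from hgap.ne')]
  change _ = _ * (gap F z ^ (m : ℤ) / gap F z ^ ((d : ℤ) + 2))
  norm_cast
  ring

omit hF in
lemma hartogsWeight_eq_zero_of_notMem (p : ℤ) {z : Fin (d + 1) → ℂ} (hz : z ∉ domain d x₀ F) :
    hartogsWeight x₀ F p z = 0 := by
  rw [hartogsWeight]
  by_cases ht : ‖z 0‖ ^ 2 ∈ openInterval x₀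
  · have : ¬ ∑ i : Fin d, ‖z i.succ‖ ^ 2 < F (‖z 0‖ ^ 2) := fun h => hz ⟨ht.2, h⟩
    rw [indicator_of_mem ht F, dirichletIntegrand, if_neg this, mul_zero]
  · rw [indicator_of_notMem ht, zero_mul]

lemma monomialNormSq_eq (p : ℤ) (ν : Fin (d + 1) → ℕ) :
    monomialNormSq d x₀ F p ν = ENNReal.ofReal Real.pi *
      ∫⁻ t in openInterval x₀, ENNReal.ofReal (F t ^ 2 * G F t) * ENNReal.ofReal t ^ ν 0 *
        dirichletIntegral p (fun i => ν i.succ) (F t) := by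
  have hDm := hF.isCompleteReinhardt.isOpen.measurableSet
  have h1 : monomialNormSq d x₀ F p ν = ∫⁻ z : Fin (d + 1) → ℂ,
      ((openInterval x₀).indicator (fun t => ENNReal.ofReal (F t ^ 2 * G F t)) (‖z 0‖ ^ 2) *
        ENNReal.ofReal (‖z 0‖ ^ 2) ^ ν 0) * dirichletIntegrand p (fun i => ν i.succ)
          ((openInterval x₀).indicator F (‖z 0‖ ^ 2)) (fun i => ‖z i.succ‖ ^ 2) := by
    rw [monomialNormSq, ← lintegral_indicator hDm]
    refine lintegral_congr fun z => ?_
    have e1 : (domain d x₀ F).indicator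
        (fun z => hartogsWeight x₀ F p z * ‖∏ j, z j ^ ν j‖ₑ ^ 2) z =
        hartogsWeight x₀ F p z * ‖∏ j, z j ^ ν j‖ₑ ^ 2 := by
      by_cases hz : z ∈ domain d x₀ F
      · simp [hz]
      · simp [hz, hartogsWeight_eq_zero_of_notMem p hz]
    have e2 : ‖∏ j, z j ^ ν j‖ₑ ^ 2 = ENNReal.ofReal (‖z 0‖ ^ 2) ^ ν 0 *
        ∏ i : Fin d, ENNReal.ofReal (‖z i.succ‖ ^ 2) ^ ν i.succ := by
      rw [← Fin.prod_univ_succ (f := fun j => ENNReal.ofReal (‖z j‖ ^ 2) ^ ν j), ← ofReal_norm,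
        norm_prod, ENNReal.ofReal_prod_of_nonneg (fun j _ => norm_nonneg _), ← Finset.prod_pow]
      refine Finset.prod_congr rfl fun j _ => ?_
      rw [norm_pow, ENNReal.ofReal_pow (norm_nonneg _), ENNReal.ofReal_pow (norm_nonneg _)]
      ring
    rw [e1, e2, hartogsWeight, dirichletIntegrand, dirichletIntegrand]
    split_ifs
    · simp only [Pi.zero_apply, pow_zero, Finset.prod_const_one, one_mul]
      ring
    · simp
  have hm : Measurable fun t : ℝ => (openInterval x₀).indicator
      (fun t => ENNReal.ofReal (F t ^ 2 * G F t)) t * ENNReal.ofReal t ^ ν 0 :=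
    hF.measurable_indicator_density.mul (by fun_prop)
  rw [h1, lintegral_hartogs_monomial hm hF.measurable_indicator,
    ← lintegral_indicator measurableSet_Ioi,
    ← lintegral_indicator (isOpen_openInterval x₀).measurableSet]
  congr 1
  refine lintegral_congr fun t => ?_
  by_cases ht : t ∈ openInterval x₀
  · rw [indicator_of_mem (show t ∈ Ioi 0 from ht.1), indicator_of_mem ht, indicator_of_mem ht,
      indicator_of_mem ht]
  · rw [indicator_of_notMem ht, indicator_apply]
    split_ifs
    · rw [indicator_of_notMem ht, zero_mul, zero_mul]
    · rfl

lemma c_ne_zero (k m : ℕ) : c x₀ F k m ≠ 0 := by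
  have hpos : ∀ t ∈ openInterval x₀, 0 < t ^ k * F t ^ m * G F t := fun t ht =>
    mul_pos (mul_pos (pow_pos ht.1 k) (pow_pos (hF.pos t ht.1.le ht.2) m)) (hF.G_pos ht)
  have hm : Measurable fun t => ENNReal.ofReal
      (t ^ k * (openInterval x₀).indicator F t ^ m * G F t) :=
    (((measurable_id.pow_const k).mul (hF.measurable_indicator.pow_const m)).mul
      (measurable_G F)).ennreal_ofReal
  have e : c x₀ F k m = ∫⁻ t in openInterval x₀, ENNReal.ofReal
      (t ^ k * (openInterval x₀).indicator F t ^ m * G F t) := by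
    refine setLIntegral_congr_fun (isOpen_openInterval x₀).measurableSet fun t ht => ?_
    simp only [indicator_of_mem (show t ∈ openInterval x₀ from ht)]
  rw [e]
  refine ((setLIntegral_pos_iff hm).2 ?_).ne'
  refine lt_of_lt_of_le ((isOpen_openInterval x₀).measure_pos volume
    (openInterval_nonempty hF.x₀_pos)) (measure_mono fun t ht => ⟨?_, ht⟩)
  simp only [Function.mem_support, indicator_of_mem ht]
  simpa using hpos t ht

/-- The norms of the monomials in terms of the moments of the profile. -/
theorem monomialNormSq_natCast (q : ℕ) (ν : Fin (d + 1) → ℕ) :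
    monomialNormSq d x₀ F (q : ℤ) ν = ENNReal.ofReal
      (Real.pi ^ (d + 1) * ((∏ i : Fin d, (ν i.succ).factorial : ℕ) * q.factorial /
        (∑ i : Fin d, ν i.succ + d + q).factorial : ℝ)) *
      c x₀ F (ν 0) (∑ i : Fin d, ν i.succ + d + q + 2) := by
  set s := ∑ i : Fin d, ν i.succ
  set C : ℝ := Real.pi ^ d * ((∏ i : Fin d, (ν i.succ).factorial : ℕ) * q.factorial /
        (s + d + q).factorial : ℝ)
  have hC : 0 ≤ C := by positivity
  have hS := (isOpen_openInterval x₀).measurableSet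
  rw [hF.monomialNormSq_eq, c]
  have e : ∀ t ∈ openInterval x₀, ENNReal.ofReal (F t ^ 2 * G F t) * ENNReal.ofReal t ^ ν 0 *
      dirichletIntegral (q : ℤ) (fun i => ν i.succ) (F t) = ENNReal.ofReal C *
        ENNReal.ofReal (t ^ ν 0 * F t ^ (s + d + q + 2) * G F t) := fun t ht => by
    have hFt := hF.pos t ht.1.le ht.2
    have hG := hF.G_pos ht
    have ht0 : 0 < t := ht.1
    rw [dirichletIntegral_natCast, if_pos hFt, ← ENNReal.ofReal_pow ht0.le,
      ← ENNReal.ofReal_mul (by positivity), ← ENNReal.ofReal_mul (by positivity),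
      ← ENNReal.ofReal_mul hC]
    congr 1
    simp only [C]
    ring
  rw [setLIntegral_congr_fun hS e, lintegral_const_mul' _ _ ENNReal.ofReal_ne_top, ← mul_assoc,
    ← ENNReal.ofReal_mul Real.pi_pos.le]
  congr 2
  simp only [C]
  ring

omit hF in
theorem monomialNormSq_eq_top {d : ℕ} (hF : IsKahlerProfile (d + 1) x₀ F) {p : ℤ} (hp : p < 0)
    (ν : Fin (d + 1 + 1) → ℕ) : monomialNormSq (d + 1) x₀ F p ν = ⊤ := by
  rw [hF.monomialNormSq_eq]
  have e : ∀ t ∈ openInterval x₀, ENNReal.ofReal (F t ^ 2 * G F t) * ENNReal.ofReal t ^ ν 0 *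
      dirichletIntegral p (fun i => ν i.succ) (F t) = ⊤ := fun t ht => by
    have hFt := hF.pos t ht.1.le ht.2
    have hG := hF.G_pos ht
    rw [dirichletIntegral_eq_top hp _ hFt, ENNReal.mul_top]
    refine mul_ne_zero ?_ (pow_ne_zero _ (by simpa using ht.1))
    simpa using (by positivity : 0 < F t ^ 2 * G F t)
  rw [setLIntegral_congr_fun (isOpen_openInterval x₀).measurableSet e, setLIntegral_const,
    ENNReal.top_mul ((isOpen_openInterval x₀).measure_pos volume
      (openInterval_nonempty hF.x₀_pos)).ne', ENNReal.mul_top (by simpa using Real.pi_pos)]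

lemma monomialNormSq_natCast_ne_zero (q : ℕ) (ν : Fin (d + 1) → ℕ) :
    monomialNormSq d x₀ F (q : ℤ) ν ≠ 0 := by
  rw [hF.monomialNormSq_natCast]
  refine mul_ne_zero ?_ (hF.c_ne_zero _ _)
  rw [← pos_iff_ne_zero, ENNReal.ofReal_pos]
  have h : 0 < ∏ i : Fin d, (ν i.succ).factorial := Finset.prod_pos fun i _ => Nat.factorial_pos _
  positivity

lemma tsum_pow_mul_c_inv {γ : ℝ} {m : ℕ} (hγ : SumCondition x₀ F γ m) {t : ℝ} (ht : 0 ≤ t)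
    (htx : (t : EReal) < x₀) :
    ∑' k : ℕ, ENNReal.ofReal t ^ k * (c x₀ F k m)⁻¹ =
      ENNReal.ofReal (((m : ℝ) - 1 + γ) * (F t ^ m)⁻¹) := by
  have h := hγ t ht htx
  rw [← h.tsum_eq, ENNReal.ofReal_tsum_of_nonneg (fun k => by positivity) h.summable]
  refine tsum_congr fun k => ?_
  rw [ENNReal.ofReal_mul (by positivity), ENNReal.ofReal_pow ht,
    ENNReal.ofReal_toReal (ENNReal.inv_ne_top.2 (hF.c_ne_zero k m))]

lemma sub_one_add_nonneg {γ : ℝ} {m : ℕ} (hγ : SumCondition x₀ F γ m) : 0 ≤ (m : ℝ) - 1 + γ := by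
  have hx : ((0 : ℝ) : EReal) < x₀ := by simpa using hF.x₀_pos
  have h : 0 ≤ ((m : ℝ) - 1 + γ) * (F 0 ^ m)⁻¹ := (hγ 0 le_rfl hx).nonneg fun k => by positivity
  have h0 := hF.pos 0 le_rfl hx
  exact nonneg_of_mul_nonneg_left h (by positivity)

/-- The diagonal of the reproducing kernel, as a sum over monomials. -/
theorem tsum_monomial_div_normSq {γ : ℝ} (hγ : ∀ m : ℕ, 1 ≤ m → SumCondition x₀ F γ m) (q : ℕ)
    {z : Fin (d + 1) → ℂ} (hz : z ∈ domain d x₀ F) :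
    ∑' ν : Fin (d + 1) → ℕ, ‖∏ j, z j ^ ν j‖ₑ ^ 2 * (monomialNormSq d x₀ F (q : ℤ) ν)⁻¹ =
      ENNReal.ofReal ((∏ l ∈ Finset.Icc 2 (d + 1), (((q + d + 2 : ℕ) : ℝ) - l)) /
                (Real.pi ^ (d + 1) *
                  (F (‖z 0‖ ^ 2) - tailSq z) ^ (q + d + 2)) *
              (((q + d + 2 : ℕ) : ℝ) - 1 + (1 - tailSq z / F (‖z 0‖ ^ 2)) * γ)) := by
  set t := ‖z 0‖ ^ 2
  have ht : 0 ≤ t := by positivity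
  have hFt : 0 < F t := hF.pos t ht hz.1
  have hs0 : 0 ≤ tailSq z := Finset.sum_nonneg fun i _ => by positivity
  set s := tailSq z
  have hs : s < F t := hz.2
  set w := s / F t
  have hw0 : 0 ≤ w := by positivity
  have hw1 : w < 1 := (div_lt_one hFt).2 hs
  have hw : ‖w‖ < 1 := by rwa [Real.norm_of_nonneg hw0]
  set M := q + d
  let φ : ℕ → ENNReal := fun a => ENNReal.ofReal ((a + M).factorial /
    (Real.pi ^ (d + 1) * q.factorial) * ((M + 1 + a + γ) * (F t ^ (a + M + 2))⁻¹))
  have hnn : ∀ a : ℕ, (0 : ℝ) ≤ M + 1 + a + γ := fun a => by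
    have := hF.sub_one_add_nonneg (hγ (a + M + 2) (by omega))
    push_cast at this
    linarith
  have hterm : ∀ (k : ℕ) (α : Fin d → ℕ),
      ‖∏ j, z j ^ (Fin.cons k α : Fin (d + 1) → ℕ) j‖ₑ ^ 2 *
        (monomialNormSq d x₀ F (q : ℤ) (Fin.cons k α))⁻¹ =
      (∏ i : Fin d, ENNReal.ofReal (‖z i.succ‖ ^ 2) ^ α i) *
        (∏ i, ((α i).factorial : ENNReal)⁻¹) *
        ENNReal.ofReal ((∑ i, α i + M).factorial / (Real.pi ^ (d + 1) * q.factorial)) *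
        (ENNReal.ofReal t ^ k * (c x₀ F k (∑ i, α i + M + 2))⁻¹) := fun k α => by
    have e2 : ‖∏ j, z j ^ (Fin.cons k α : Fin (d + 1) → ℕ) j‖ₑ ^ 2 =
        ENNReal.ofReal t ^ k * ∏ i : Fin d, ENNReal.ofReal (‖z i.succ‖ ^ 2) ^ α i := by
      rw [← ofReal_norm, norm_prod, ENNReal.ofReal_prod_of_nonneg (fun j _ => norm_nonneg _),
        ← Finset.prod_pow, Fin.prod_univ_succ]
      simp only [Fin.cons_zero, Fin.cons_succ, t]
      congr 1
      · rw [norm_pow, ENNReal.ofReal_pow (norm_nonneg _), ENNReal.ofReal_pow (norm_nonneg _)]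
        ring
      · refine Finset.prod_congr rfl fun j _ => ?_
        rw [norm_pow, ENNReal.ofReal_pow (norm_nonneg _), ENNReal.ofReal_pow (norm_nonneg _)]
        ring
    have hP : 0 < ∏ i, (α i).factorial := Finset.prod_pos fun i _ => Nat.factorial_pos _
    have e3 : (∏ i, ((α i).factorial : ENNReal)⁻¹) =
        ENNReal.ofReal (((∏ i, (α i).factorial : ℕ) : ℝ)⁻¹) := by
      rw [ENNReal.ofReal_inv_of_pos (by positivity), ENNReal.ofReal_natCast, Nat.cast_prod,
        ENNReal.prod_inv_distrib]
      intro i _ j _ _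
      exact Or.inr (ENNReal.natCast_ne_top _)
    rw [e2, hF.monomialNormSq_natCast]
    simp only [Fin.cons_zero, Fin.cons_succ]
    have hpos : 0 < Real.pi ^ (d + 1) * (((∏ i, (α i).factorial : ℕ) : ℝ) * q.factorial /
        (∑ i, α i + M).factorial) := by positivity
    rw [show ∑ i, α i + d + q = ∑ i, α i + M by simp only [M]; ring,
      ENNReal.mul_inv (Or.inl (ENNReal.ofReal_pos.2 hpos).ne') (Or.inl ENNReal.ofReal_ne_top),
      ← ENNReal.ofReal_inv_of_pos hpos, e3]
    have e4 : ENNReal.ofReal (Real.pi ^ (d + 1) * (((∏ i, (α i).factorial : ℕ) : ℝ) *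
        q.factorial / (∑ i, α i + M).factorial))⁻¹ =
        ENNReal.ofReal (((∏ i, (α i).factorial : ℕ) : ℝ)⁻¹) *
        ENNReal.ofReal ((∑ i, α i + M).factorial / (Real.pi ^ (d + 1) * q.factorial)) := by
      rw [← ENNReal.ofReal_mul (by positivity)]
      congr 1
      field_simp
    rw [e4]
    ring
  rw [← (Fin.consEquiv fun _ : Fin (d + 1) => ℕ).tsum_eq]
  simp only [Fin.consEquiv, Equiv.coe_fn_mk]
  rw [ENNReal.tsum_prod', ENNReal.tsum_comm]
  simp only [hterm, ENNReal.tsum_mul_left]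
  have h5 : ∀ a : ℕ, ENNReal.ofReal ((a + M).factorial / (Real.pi ^ (d + 1) * q.factorial)) *
      ∑' k : ℕ, ENNReal.ofReal t ^ k * (c x₀ F k (a + M + 2))⁻¹ = φ a := fun a => by
    rw [hF.tsum_pow_mul_c_inv (hγ _ (by omega)) ht hz.1, ← ENNReal.ofReal_mul (by positivity)]
    simp only [φ]
    congr 3
    push_cast
    ring
  simp only [mul_assoc _ (ENNReal.ofReal _) (∑' k : ℕ, _), h5]
  rw [tsum_multiindex (fun i => ENNReal.ofReal (‖z i.succ‖ ^ 2)) φ,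
    ← ENNReal.ofReal_sum_of_nonneg fun i _ => by positivity]
  change ∑' a : ℕ, ENNReal.ofReal s ^ a * (a.factorial : ENNReal)⁻¹ * φ a = _
  have hser := (hasSum_kernel_series hw M γ).mul_left
    ((Real.pi ^ (d + 1) * q.factorial * F t ^ (M + 2))⁻¹)
  have hval : (∏ l ∈ Finset.Icc 2 (d + 1), (((M + 2 : ℕ) : ℝ) - l)) /
      (Real.pi ^ (d + 1) * (F t - s) ^ (M + 2)) * (((M + 2 : ℕ) : ℝ) - 1 + (1 - w) * γ) =
      (Real.pi ^ (d + 1) * q.factorial * F t ^ (M + 2))⁻¹ *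
        (M.factorial / (1 - w) ^ (M + 2) * (M + 1 + (1 - w) * γ)) := by
    have e1 : F t - s = F t * (1 - w) := by simp only [w]; field_simp
    have hw1' : 1 - w ≠ 0 := by linarith
    rw [← prod_Icc_sub_mul_factorial d q, e1, mul_pow]
    simp only [M]
    push_cast
    field_simp
    ring
  rw [hval, ← hser.tsum_eq, ENNReal.ofReal_tsum_of_nonneg
    (fun a => mul_nonneg (by positivity) (mul_nonneg (mul_nonneg (by positivity) (hnn a))
      (by positivity))) hser.summable]
  refine tsum_congr fun a => ?_
  simp only [φ]
  rw [← ENNReal.ofReal_natCast, ← ENNReal.ofReal_inv_of_pos (by positivity),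
    ← ENNReal.ofReal_pow hs0, ← ENNReal.ofReal_mul (by positivity),
    ← ENNReal.ofReal_mul (by positivity)]
  congr 1
  simp only [w, div_pow]
  field_simp
  ring

omit hF in
/-- Infinitely many monomials have finite norm. -/
theorem infinite_monomialNormSq_ne_top {d : ℕ} (hF : IsKahlerProfile (d + 1) x₀ F) {γ : ℝ}
    (hγ : ∀ m : ℕ, 1 ≤ m → SumCondition x₀ F γ m) (q : ℕ) :
    {ν : Fin (d + 1 + 1) → ℕ | monomialNormSq (d + 1) x₀ F (q : ℤ) ν ≠ ⊤}.Infinite := by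
  have hx : ((0 : ℝ) : EReal) < x₀ := by simpa using hF.x₀_pos
  have h0 := hF.pos 0 le_rfl hx
  have hex : ∀ a : ℕ, ((a + (d + 1) + q + 2 : ℕ) : ℝ) - 1 + γ ≠ 0 →
      ∃ ν : Fin (d + 1 + 1) → ℕ, monomialNormSq (d + 1) x₀ F (q : ℤ) ν ≠ ⊤ ∧ ν 1 = a := by
    intro a ha
    by_contra hcon
    push Not at hcon
    have hc : ∀ k, c x₀ F k (a + (d + 1) + q + 2) = ⊤ := by
      intro k
      by_contra hk
      refine hcon (Fin.cons k (Pi.single 0 a)) ?_ ?_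
      · rw [hF.monomialNormSq_natCast]
        simp only [Fin.cons_succ, Fin.cons_zero, Finset.sum_pi_single', Finset.mem_univ, if_true]
        exact ENNReal.mul_ne_top ENNReal.ofReal_ne_top hk
      · rw [← Fin.succ_zero_eq_one, Fin.cons_succ, Pi.single_eq_same]
    have hs := hγ (a + (d + 1) + q + 2) (by omega) 0 le_rfl hx
    simp only [hc, ENNReal.inv_top, ENNReal.toReal_zero, mul_zero] at hs
    have := hs.unique hasSum_zero
    exact mul_ne_zero ha (by positivity) this
  intro hfin
  obtain ⟨B, hB⟩ := (hfin.image fun ν => ν 1).bddAbove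
  have hle : ∀ a : ℕ, ((a + (d + 1) + q + 2 : ℕ) : ℝ) - 1 + γ ≠ 0 → a ≤ B := fun a ha => by
    obtain ⟨ν, hν, rfl⟩ := hex a ha
    exact hB ⟨ν, hν, rfl⟩
  have h1 : ((B + 1 + (d + 1) + q + 2 : ℕ) : ℝ) - 1 + γ = 0 := by
    by_contra h
    have := hle _ h
    omega
  have h2 : ((B + 2 + (d + 1) + q + 2 : ℕ) : ℝ) - 1 + γ = 0 := by
    by_contra h
    have := hle _ h
    omega
  push_cast at h1 h2
  linarith

end IsKahlerProfile

end Profile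

end Hartogs

namespace Hartogs

section Hilbert

variable {V E J : Type*} [AddCommGroup V] [Module ℂ V] [NormedAddCommGroup E]
  [InnerProductSpace ℂ E] {τ : V →ₗ[ℂ] E} {T : V →ₗ[ℂ] lp (fun _ : J => ℂ) 2}

lemma inner_map_map_of_norm_eq (hT : ∀ v, ‖T v‖ = ‖τ v‖) (u v : V) :
    inner ℂ (T u) (T v) = inner ℂ (τ u) (τ v) := by
  rw [inner_eq_sum_norm_sq_div_four, inner_eq_sum_norm_sq_div_four]
  simp only [← map_add, ← map_sub, ← map_smul, hT]

lemma mem_closure_span_map_of_norm_eq (hT : ∀ v, ‖T v‖ = ‖τ v‖) {ι : Type*} {f : ι → V} {v : V}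
    (hv : τ v ∈ (Submodule.span ℂ (range fun j => τ (f j))).topologicalClosure) :
    T v ∈ (Submodule.span ℂ (range fun j => T (f j))).topologicalClosure := by
  rw [← SetLike.mem_coe, Submodule.topologicalClosure_coe, Metric.mem_closure_iff] at hv ⊢
  intro ε hε
  obtain ⟨y, hy, hd⟩ := hv ε hε
  have e1 : (range fun j => τ (f j)) = τ '' range f := by rw [← range_comp]; rfl
  have e2 : (range fun j => T (f j)) = T '' range f := by rw [← range_comp]; rfl
  rw [e1, SetLike.mem_coe, Submodule.span_image] at hy
  obtain ⟨g, hg, rfl⟩ := hy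
  refine ⟨T g, ?_, ?_⟩
  · rw [e2, SetLike.mem_coe, Submodule.span_image]
    exact ⟨g, hg, rfl⟩
  · rw [dist_eq_norm, ← map_sub] at hd ⊢
    rwa [hT]

variable [DecidableEq J] {e : J → V}

lemma orthonormal_of_map_eq_single (hT : ∀ v, ‖T v‖ = ‖τ v‖)
    (he : ∀ j, T (e j) = lp.single 2 j 1) : Orthonormal ℂ fun j => τ (e j) := by
  rw [orthonormal_iff_ite]
  intro i j
  rw [← inner_map_map_of_norm_eq hT, he, he, lp.inner_single_left, lp.single_apply]
  by_cases h : i = j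
  · subst h; simp
  · simp [h]

lemma mem_closure_span_of_map_eq_single (hT : ∀ v, ‖T v‖ = ‖τ v‖)
    (he : ∀ j, T (e j) = lp.single 2 j 1) (v : V) :
    τ v ∈ (Submodule.span ℂ (range fun j => τ (e j))).topologicalClosure := by
  rw [← SetLike.mem_coe, Submodule.topologicalClosure_coe]
  have hs := lp.hasSum_single (E := fun _ : J => ℂ) (p := 2) (by simp) (T v)
  have hτ : HasSum (fun j => τ ((T v : J → ℂ) j • e j)) (τ v) := by
    rw [HasSum, tendsto_iff_norm_sub_tendsto_zero] at hs ⊢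
    refine hs.congr fun s => ?_
    rw [← map_sum, ← map_sub, ← hT, map_sub, map_sum]
    simp only [map_smul, he]
    congr 3
    ext1 j
    rw [← lp.single_smul]
    simp
  refine mem_closure_of_tendsto hτ (Filter.Eventually.of_forall fun s => ?_)
  refine Submodule.sum_mem _ fun j _ => ?_
  rw [map_smul]
  exact Submodule.smul_mem _ _ (Submodule.subset_span ⟨j, rfl⟩)

/-- Parseval's identity for an arbitrary orthonormal basis, transported to `ℓ²`. -/
theorem hasSum_norm_sq_inner_of_map_eq_single (hT : ∀ v, ‖T v‖ = ‖τ v‖)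
    (he : ∀ j, T (e j) = lp.single 2 j 1) {ι : Type*} {f : ι → V}
    (hf : Orthonormal ℂ fun j => τ (f j))
    (hd : ∀ v, τ v ∈ (Submodule.span ℂ (range fun j => τ (f j))).topologicalClosure)
    (κ : lp (fun _ : J => ℂ) 2) :
    HasSum (fun j => ‖inner ℂ κ (T (f j))‖ ^ 2) (‖κ‖ ^ 2) := by
  have horth : Orthonormal ℂ fun j => T (f j) := by
    classical
    rw [orthonormal_iff_ite] at hf ⊢
    simpa only [inner_map_map_of_norm_eq hT] using hf
  have hdense : ⊤ ≤ (Submodule.span ℂ (range fun j => T (f j))).topologicalClosure := by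
    intro x _
    have hs := lp.hasSum_single (E := fun _ : J => ℂ) (p := 2) (by simp) x
    refine (Submodule.isClosed_topologicalClosure _).mem_of_tendsto hs
      (Filter.Eventually.of_forall fun s => Submodule.sum_mem _ fun j _ => ?_)
    have e1 : lp.single 2 j (x j) = (x : J → ℂ) j • T (e j) := by
      rw [he, ← lp.single_smul]
      simp
    rw [e1]
    exact Submodule.smul_mem _ _ (mem_closure_span_map_of_norm_eq hT (hd (e j)))
  have h := (HilbertBasis.mk horth hdense).hasSum_inner_mul_inner κ κ
  have h2 := RCLike.hasSum_re ℂ h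
  rw [inner_self_eq_norm_sq] at h2
  refine h2.congr_fun fun j => ?_
  rw [HilbertBasis.coe_mk, ← inner_conj_symm (T (f j)) κ, RCLike.mul_conj]
  norm_cast

end Hilbert

end Hartogs

namespace Hartogs

section Sequences

variable {J : Type*}

lemma toReal_enorm_sq (x : ℂ) : (‖x‖ₑ ^ 2).toReal = ‖x‖ ^ 2 := by
  rw [ENNReal.toReal_pow, toReal_enorm]

lemma memℓp_two_of_tsum_ne_top {x : J → ℂ} (h : ∑' j, ‖x j‖ₑ ^ 2 ≠ ⊤) : Memℓp x 2 := by
  refine memℓp_gen ((ENNReal.summable_toReal h).congr fun j => ?_)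
  rw [toReal_enorm_sq, ENNReal.toReal_ofNat, Real.rpow_ofNat]

lemma lp_norm_sq_eq_toReal_tsum (x : lp (fun _ : J => ℂ) 2) :
    ‖x‖ ^ 2 = (∑' j, ‖(x : J → ℂ) j‖ₑ ^ 2).toReal := by
  have h := lp.norm_rpow_eq_tsum (p := 2) (by simp) x
  rw [ENNReal.toReal_ofNat, Real.rpow_ofNat] at h
  rw [h, ENNReal.tsum_toReal_eq fun j => ENNReal.pow_ne_top enorm_ne_top]
  refine tsum_congr fun j => ?_
  rw [toReal_enorm_sq, Real.rpow_ofNat]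

end Sequences

section Monomials

variable {ι : Type*} [Fintype ι]

lemma torusCoeff_congr {h h' : (ι → ℂ) → ℂ} {D : Set (ι → ℂ)} (hD : IsCompleteReinhardt D)
    (hh : EqOn h h' D) {z : ι → ℂ} (hz : z ∈ D) (ν : ι → ℤ) :
    torusCoeff h ν z = torusCoeff h' ν z := by
  simp only [torusCoeff]
  congr 1
  ext x
  rw [hh (hD.torusRotate_mem hz x)]

lemma taylorCoeff_monomial [DecidableEq ι] {w : ι → ℂ} (hw0 : ∀ j, w j ≠ 0) (ν k : ι → ℕ) :
    taylorCoeff w (fun z => ∏ j, z j ^ ν j) k = if k = ν then 1 else 0 := by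
  have h1 : ∀ x : ι → UnitAddCircle,
      UnitAddTorus.mFourier (-fun j => (k j : ℤ)) x * ∏ j, torusRotate x w j ^ ν j =
        ∏ j, (fourier (-(k j : ℤ)) (x j) * fourier (ν j : ℤ) (x j)) * w j ^ ν j := fun x => by
    simp only [UnitAddTorus.mFourier, ContinuousMap.coe_mk, Pi.neg_apply, torusRotate, mul_pow,
      ← fourier_natCast_apply, ← Finset.prod_mul_distrib]
    exact Finset.prod_congr rfl fun j _ => by ring
  have h2 : torusCoeff (fun z => ∏ j, z j ^ ν j) (fun j => (k j : ℤ)) w =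
      if k = ν then ∏ j, w j ^ ν j else 0 := by
    simp only [torusCoeff, h1]
    rw [integral_fintype_prod_eq_prod (f := fun j (φ : UnitAddCircle) =>
      fourier (-(k j : ℤ)) φ * fourier (ν j : ℤ) φ * w j ^ ν j)]
    simp only [integral_mul_const, integral_fourier_mul_fourier, Nat.cast_inj]
    split_ifs with hk
    · subst hk; simp
    · obtain ⟨j, hj⟩ := Function.ne_iff.1 hk
      exact Finset.prod_eq_zero (Finset.mem_univ j) (by simp [Ne.symm hj])
  rw [taylorCoeff, h2]
  split_ifs with hk
  · subst hk
    exact div_self (Finset.prod_ne_zero_iff.2 fun j _ => pow_ne_zero _ (hw0 j))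
  · simp

end Monomials

section ZeroExtend

variable {n : ℕ} {M : Set (Fin n → ℂ)}

/-- Extension by zero of functions on a subset of `ℂⁿ`. -/
noncomputable def zeroExtend (M : Set (Fin n → ℂ)) : (M → ℂ) →ₗ[ℂ] ((Fin n → ℂ) → ℂ) :=
  Function.ExtendByZero.linearMap ℂ (Subtype.val : M → Fin n → ℂ)

@[simp] lemma zeroExtend_coe (f : M → ℂ) (z : M) : zeroExtend M f z = f z :=
  Subtype.val_injective.extend_apply f 0 z

lemma IsHolomorphic.differentiableOn_zeroExtend {f : M → ℂ} (hf : IsHolomorphic f) :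
    DifferentiableOn ℂ (zeroExtend M f) M := by
  obtain ⟨g, hg, hfg⟩ := hf
  refine hg.congr fun z hz => ?_
  rw [← hfg ⟨z, hz⟩]
  exact zeroExtend_coe f ⟨z, hz⟩

lemma IsHolomorphic.continuous {f : M → ℂ} (hf : IsHolomorphic f) : Continuous f := by
  obtain ⟨g, hg, hfg⟩ := hf
  rw [show f = M.domRestrict g from funext hfg]
  exact hg.continuousOn.domRestrict

/-- `toL2` as a linear map. -/
noncomputable def toL2Linear (M : Set (Fin n → ℂ)) (Φ : (Fin n → ℂ) → ℝ) (m : ℕ) :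
    weightedSpace M Φ m →ₗ[ℂ] Lp ℂ 2 (weightedMeasure M Φ m) where
  toFun := toL2
  map_add' f g := MemLp.toLp_add f.2.2 g.2.2
  map_smul' c f := MemLp.toLp_const_smul c f.2.2

lemma eLpNorm_two_sq {α : Type*} [MeasurableSpace α] (μ : Measure α) (f : α → ℂ) :
    eLpNorm f 2 μ ^ 2 = ∫⁻ x, ‖f x‖ₑ ^ 2 ∂μ := by
  have := eLpNorm_nnreal_pow_eq_lintegral (μ := μ) (f := f) (p := 2) two_ne_zero
  simpa using this

lemma norm_toL2_sq {Φ : (Fin n → ℂ) → ℝ} {m : ℕ} (f : weightedSpace M Φ m) :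
    ‖toL2 f‖ ^ 2 = (∫⁻ z, ‖(f : M → ℂ) z‖ₑ ^ 2 ∂weightedMeasure M Φ m).toReal := by
  rw [toL2, Lp.norm_toLp, ← ENNReal.toReal_pow, eLpNorm_two_sq]

lemma lintegral_enorm_sq_ne_top {Φ : (Fin n → ℂ) → ℝ} {m : ℕ} (f : weightedSpace M Φ m) :
    ∫⁻ z, ‖(f : M → ℂ) z‖ₑ ^ 2 ∂weightedMeasure M Φ m ≠ ⊤ := by
  rw [← eLpNorm_two_sq]
  exact ENNReal.pow_ne_top f.2.2.2.ne

lemma mem_weightedSpace_of_lintegral_ne_top {Φ : (Fin n → ℂ) → ℝ} {m : ℕ} {f : M → ℂ}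
    (hf : IsHolomorphic f) (h : ∫⁻ z, ‖f z‖ₑ ^ 2 ∂weightedMeasure M Φ m ≠ ⊤) :
    f ∈ weightedSpace M Φ m := by
  refine ⟨hf, hf.continuous.aestronglyMeasurable, lt_top_iff_ne_top.2 fun htop => h ?_⟩
  rw [← eLpNorm_two_sq, htop]
  rfl

end ZeroExtend

namespace IsKahlerProfile

variable {d : ℕ} {x₀ : EReal} {F : ℝ → ℝ} (hF : IsKahlerProfile d x₀ F)
include hF

lemma weightedMeasure_eq (m : ℕ) :
    weightedMeasure (domain d x₀ F) (potential d F) m =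
      ((volume : Measure (Fin (d + 1) → ℂ)).comap Subtype.val).withDensity
        fun z : domain d x₀ F => hartogsWeight x₀ F ((m : ℤ) - (d + 2)) z.1 := by
  refine withDensity_congr_ae ?_
  have hDm := hF.isCompleteReinhardt.isOpen.measurableSet
  have h0 : ∀ᵐ z : Fin (d + 1) → ℂ, z 0 ≠ 0 := by
    rw [ae_iff]
    simp only [not_not]
    exact Measure.pi_hyperplane (fun _ : Fin (d + 1) => (volume : Measure ℂ)) 0 0
  have h1 := (ae_restrict_iff_subtype hDm).1
    (ae_restrict_of_ae (s := domain d x₀ F) h0)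
  filter_upwards [h1] with z hz
  exact hF.ofReal_exp_mul_det_eq_hartogsWeight m z.2 hz

lemma lintegral_weightedMeasure (m : ℕ) {f : domain d x₀ F → ℂ} (hf : IsHolomorphic f) :
    ∫⁻ z, ‖f z‖ₑ ^ 2 ∂weightedMeasure (domain d x₀ F) (potential d F) m =
      ∫⁻ z in domain d x₀ F, hartogsWeight x₀ F ((m : ℤ) - (d + 2)) z *
        ‖zeroExtend (domain d x₀ F) f z‖ₑ ^ 2 := by
  have hDm := hF.isCompleteReinhardt.isOpen.measurableSet
  have hm : Measurable fun z : domain d x₀ F => hartogsWeight x₀ F ((m : ℤ) - (d + 2)) z.1 :=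
    (hF.measurable_hartogsWeight _).comp measurable_subtype_coe
  rw [hF.weightedMeasure_eq, lintegral_withDensity_eq_lintegral_mul _ hm
    (hf.continuous.enorm.measurable.pow_const 2), ← lintegral_subtype_comap hDm]
  refine lintegral_congr fun z => ?_
  rw [Pi.mul_apply, zeroExtend_coe]

variable {w : Fin (d + 1) → ℂ}

/-- The norm of a holomorphic function in terms of its Taylor coefficients. -/
theorem lintegral_enorm_sq_eq_tsum (hw : w ∈ domain d x₀ F) (hw0 : ∀ j, w j ≠ 0) (m : ℕ)
    {f : domain d x₀ F → ℂ} (hf : IsHolomorphic f) :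
    ∫⁻ z, ‖f z‖ₑ ^ 2 ∂weightedMeasure (domain d x₀ F) (potential d F) m =
      ∑' ν, ‖taylorCoeff w (zeroExtend _ f) ν‖ₑ ^ 2 *
        monomialNormSq d x₀ F ((m : ℤ) - (d + 2)) ν := by
  rw [hF.lintegral_weightedMeasure m hf]
  exact setLIntegral_enorm_sq_eq_tsum hF.isCompleteReinhardt hf.differentiableOn_zeroExtend hw hw0
    (hF.measurable_hartogsWeight _) (hartogsWeight_torusRotate _)

lemma taylorCoeff_eq_zero (hw : w ∈ domain d x₀ F) (hw0 : ∀ j, w j ≠ 0) {m : ℕ}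
    (f : weightedSpace (domain d x₀ F) (potential d F) m) {ν : Fin (d + 1) → ℕ}
    (hν : monomialNormSq d x₀ F ((m : ℤ) - (d + 2)) ν = ⊤) :
    taylorCoeff w (zeroExtend _ (f : domain d x₀ F → ℂ)) ν = 0 := by
  by_contra h
  refine lintegral_enorm_sq_ne_top f ?_
  rw [hF.lintegral_enorm_sq_eq_tsum hw hw0 m f.2.1]
  refine ENNReal.tsum_eq_top_of_eq_top ⟨ν, ?_⟩
  rw [hν, ENNReal.mul_top]
  exact pow_ne_zero 2 (enorm_ne_zero.2 h)

/-- The weighted space vanishes when no monomial has finite norm. -/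
theorem weightedSpace_eq_bot {m : ℕ}
    (h : ∀ ν, monomialNormSq d x₀ F ((m : ℤ) - (d + 2)) ν = ⊤) :
    weightedSpace (domain d x₀ F) (potential d F) m = ⊥ := by
  obtain ⟨w, hw, hw0⟩ := hF.exists_mem_domain_ne_zero
  rw [Submodule.eq_bot_iff]
  intro f hf
  have hz := fun ν => hF.taylorCoeff_eq_zero hw hw0 ⟨f, hf⟩ (h ν)
  ext z
  have hs := hasSum_taylorCoeff hF.isCompleteReinhardt hf.1.differentiableOn_zeroExtend hw hw0 z.2
    (by simpa only [hz, zero_mul] using summable_zero)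
  simp only [hz, zero_mul] at hs
  rw [← zeroExtend_coe f z]
  exact hs.unique hasSum_zero

lemma tsum_enorm_sq_taylorCoeff_mul_sqrt (hw : w ∈ domain d x₀ F) (hw0 : ∀ j, w j ≠ 0) {m : ℕ}
    (f : weightedSpace (domain d x₀ F) (potential d F) m) :
    ∑' ν : {ν // monomialNormSq d x₀ F ((m : ℤ) - (d + 2)) ν ≠ ⊤},
      ‖taylorCoeff w (zeroExtend _ (f : domain d x₀ F → ℂ)) ν *
        ((Real.sqrt (monomialNormSq d x₀ F ((m : ℤ) - (d + 2)) ν).toReal : ℝ) : ℂ)‖ₑ ^ 2 =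
      ∫⁻ z, ‖(f : domain d x₀ F → ℂ) z‖ₑ ^ 2
        ∂weightedMeasure (domain d x₀ F) (potential d F) m := by
  rw [hF.lintegral_enorm_sq_eq_tsum hw hw0 m f.2.1, ← tsum_subtype_eq_of_support_subset
    (s := {ν | monomialNormSq d x₀ F ((m : ℤ) - (d + 2)) ν ≠ ⊤})]
  · refine tsum_congr fun ν => ?_
    have hν := ν.2
    rw [enorm_mul, mul_pow]
    congr 1
    rw [← ofReal_norm, Complex.norm_real, Real.norm_of_nonneg (Real.sqrt_nonneg _),
      ← ENNReal.ofReal_pow (Real.sqrt_nonneg _), Real.sq_sqrt ENNReal.toReal_nonneg,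
      ENNReal.ofReal_toReal hν]
  · intro ν hν htop
    exact hν (by simp only [hF.taylorCoeff_eq_zero hw hw0 f htop, enorm_zero]; simp)

/-- The isometry of the weighted space into `ℓ²` given by the normalized Taylor coefficients. -/
noncomputable def coeffMap (hw : w ∈ domain d x₀ F) (hw0 : ∀ j, w j ≠ 0) (m : ℕ) :
    weightedSpace (domain d x₀ F) (potential d F) m →ₗ[ℂ]
      lp (fun _ : {ν // monomialNormSq d x₀ F ((m : ℤ) - (d + 2)) ν ≠ ⊤} => ℂ) 2 where
  toFun f := ⟨fun ν => taylorCoeff w (zeroExtend _ (f : domain d x₀ F → ℂ)) ν *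
      ((Real.sqrt (monomialNormSq d x₀ F ((m : ℤ) - (d + 2)) ν).toReal : ℝ) : ℂ),
    memℓp_two_of_tsum_ne_top (by
      rw [hF.tsum_enorm_sq_taylorCoeff_mul_sqrt hw hw0 f]
      exact lintegral_enorm_sq_ne_top f)⟩
  map_add' f g := by
    ext ν
    simp only [Submodule.coe_add, map_add, lp.coeFn_add, Pi.add_apply, taylorCoeff]
    rw [torusCoeff_add hF.isCompleteReinhardt f.2.1.differentiableOn_zeroExtend
      g.2.1.differentiableOn_zeroExtend hw]
    ring
  map_smul' c f := by
    ext ν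
    simp only [SetLike.val_smul, map_smul, lp.coeFn_smul, Pi.smul_apply, taylorCoeff,
      torusCoeff_smul, RingHom.id_apply, smul_eq_mul]
    ring

lemma norm_coeffMap (hw : w ∈ domain d x₀ F) (hw0 : ∀ j, w j ≠ 0) (m : ℕ)
    (f : weightedSpace (domain d x₀ F) (potential d F) m) :
    ‖hF.coeffMap hw hw0 m f‖ = ‖toL2Linear _ _ m f‖ := by
  rw [← sq_eq_sq₀ (norm_nonneg _) (norm_nonneg _)]
  change _ = ‖toL2 f‖ ^ 2
  rw [norm_toL2_sq, lp_norm_sq_eq_toReal_tsum, ← hF.tsum_enorm_sq_taylorCoeff_mul_sqrt hw hw0 f]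
  rfl

lemma monomial_mem_weightedSpace {m : ℕ} {ν : Fin (d + 1) → ℕ}
    (hν : monomialNormSq d x₀ F ((m : ℤ) - (d + 2)) ν ≠ ⊤) :
    (fun z : domain d x₀ F => ∏ j, z.1 j ^ ν j) ∈
      weightedSpace (domain d x₀ F) (potential d F) m := by
  have hol : IsHolomorphic (fun z : domain d x₀ F => ∏ j, z.1 j ^ ν j) :=
    ⟨fun z => ∏ j, z j ^ ν j, Differentiable.differentiableOn (by fun_prop), fun _ => rfl⟩
  refine mem_weightedSpace_of_lintegral_ne_top hol ?_
  rw [hF.lintegral_weightedMeasure m hol]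
  convert hν using 1
  refine setLIntegral_congr_fun hF.isCompleteReinhardt.isOpen.measurableSet fun z hz => ?_
  have := zeroExtend_coe (fun z : domain d x₀ F => ∏ j, z.1 j ^ ν j) ⟨z, hz⟩
  simp only at this
  simp only [this]

/-- The normalized monomials of finite norm. -/
noncomputable def monomialBasis (m : ℕ)
    (ν : {ν // monomialNormSq d x₀ F ((m : ℤ) - (d + 2)) ν ≠ ⊤}) :
    weightedSpace (domain d x₀ F) (potential d F) m :=
  ((Real.sqrt (monomialNormSq d x₀ F ((m : ℤ) - (d + 2)) ν).toReal : ℝ) : ℂ)⁻¹ •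
    ⟨_, hF.monomial_mem_weightedSpace ν.2⟩

lemma coeffMap_monomialBasis (hw : w ∈ domain d x₀ F) (hw0 : ∀ j, w j ≠ 0) {m : ℕ}
    (h0 : ∀ ν, monomialNormSq d x₀ F ((m : ℤ) - (d + 2)) ν ≠ 0)
    (ν : {ν // monomialNormSq d x₀ F ((m : ℤ) - (d + 2)) ν ≠ ⊤}) :
    hF.coeffMap hw hw0 m (hF.monomialBasis m ν) = lp.single 2 ν 1 := by
  have hpos : 0 < Real.sqrt (monomialNormSq d x₀ F ((m : ℤ) - (d + 2)) ν).toReal :=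
    Real.sqrt_pos.2 (ENNReal.toReal_pos (h0 ν) ν.2)
  have hne : ((Real.sqrt (monomialNormSq d x₀ F ((m : ℤ) - (d + 2)) ν).toReal : ℝ) : ℂ) ≠ 0 := by
    exact_mod_cast hpos.ne'
  rw [monomialBasis, map_smul]
  ext k
  have h1 : taylorCoeff w (zeroExtend _ fun z : domain d x₀ F => ∏ j, z.1 j ^ ν.1 j) k.1 =
      if k = ν then 1 else 0 := by
    have e : EqOn (zeroExtend _ fun z : domain d x₀ F => ∏ j, z.1 j ^ ν.1 j)
        (fun z => ∏ j, z j ^ ν.1 j) (domain d x₀ F) := fun z hz =>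
      zeroExtend_coe (fun z : domain d x₀ F => ∏ j, z.1 j ^ ν.1 j) ⟨z, hz⟩
    rw [taylorCoeff, torusCoeff_congr hF.isCompleteReinhardt e hw, ← taylorCoeff,
      taylorCoeff_monomial hw0]
    simp only [Subtype.ext_iff]
  rw [lp.coeFn_smul, Pi.smul_apply, lp.single_apply]
  simp only [coeffMap, LinearMap.coe_mk, AddHom.coe_mk, h1, smul_eq_mul]
  by_cases hk : k = ν
  · subst hk
    simp [hne]
  · simp [hk]

theorem isOrthonormalBasis_monomialBasis {m : ℕ}
    (h0 : ∀ ν, monomialNormSq d x₀ F ((m : ℤ) - (d + 2)) ν ≠ 0) :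
    IsOrthonormalBasis (hF.monomialBasis m) := by
  obtain ⟨w, hw, hw0⟩ := hF.exists_mem_domain_ne_zero
  have hT := hF.norm_coeffMap hw hw0 m
  have he := hF.coeffMap_monomialBasis hw hw0 h0
  have h1 := orthonormal_of_map_eq_single (τ := toL2Linear _ _ m) hT he
  have h2 := mem_closure_span_of_map_eq_single (τ := toL2Linear _ _ m) hT he
  exact ⟨h1, h2⟩

/-- Point evaluation is the inner product with the kernel vector in `ℓ²`. -/
lemma inner_coeffMap (hw : w ∈ domain d x₀ F) (hw0 : ∀ j, w j ≠ 0) {m : ℕ}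
    (h0 : ∀ ν, monomialNormSq d x₀ F ((m : ℤ) - (d + 2)) ν ≠ 0) (z : domain d x₀ F)
    (κ : lp (fun _ : {ν // monomialNormSq d x₀ F ((m : ℤ) - (d + 2)) ν ≠ ⊤} => ℂ) 2)
    (hκ : ∀ ν, κ ν = star ((∏ j, z.1 j ^ ν.1 j) /
      ((Real.sqrt (monomialNormSq d x₀ F ((m : ℤ) - (d + 2)) ν).toReal : ℝ) : ℂ)))
    (g : weightedSpace (domain d x₀ F) (potential d F) m) :
    inner ℂ κ (hF.coeffMap hw hw0 m g) = (g : domain d x₀ F → ℂ) z := by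
  have h1 := lp.hasSum_inner (𝕜 := ℂ) κ (hF.coeffMap hw hw0 m g)
  have h2 : HasSum (fun ν => taylorCoeff w (zeroExtend _ (g : domain d x₀ F → ℂ)) ν *
      ∏ j, z.1 j ^ ν j) (inner ℂ κ (hF.coeffMap hw hw0 m g)) := by
    refine (Subtype.val_injective (p := fun ν =>
      monomialNormSq d x₀ F ((m : ℤ) - (d + 2)) ν ≠ ⊤)).hasSum_iff ?_ |>.1 ?_
    · intro ν hν
      have htop : monomialNormSq d x₀ F ((m : ℤ) - (d + 2)) ν = ⊤ := by
        by_contra h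
        exact hν ⟨⟨ν, h⟩, rfl⟩
      rw [hF.taylorCoeff_eq_zero hw hw0 g htop, zero_mul]
    · refine h1.congr_fun fun ν => ?_
      have hpos := Real.sqrt_pos.2 (ENNReal.toReal_pos (h0 ν) ν.2)
      have hT : hF.coeffMap hw hw0 m g ν =
          taylorCoeff w (zeroExtend _ (g : domain d x₀ F → ℂ)) ν *
            ((Real.sqrt (monomialNormSq d x₀ F ((m : ℤ) - (d + 2)) ν).toReal : ℝ) : ℂ) := rfl
      rw [hκ, hT, RCLike.inner_apply, Complex.star_def, Complex.conj_conj, Function.comp_apply]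
      have hne := Complex.ofReal_ne_zero.2 hpos.ne'
      field_simp
  have h3 := hasSum_taylorCoeff hF.isCompleteReinhardt g.2.1.differentiableOn_zeroExtend hw hw0
    z.2 h2.summable
  rw [h2.unique h3, zeroExtend_coe]

omit hF in
lemma tsum_enorm_sq_kernelVector {m : ℕ}
    (h0 : ∀ ν, monomialNormSq d x₀ F ((m : ℤ) - (d + 2)) ν ≠ 0) (z : Fin (d + 1) → ℂ) :
    ∑' ν : {ν // monomialNormSq d x₀ F ((m : ℤ) - (d + 2)) ν ≠ ⊤},
      ‖star ((∏ j, z j ^ ν.1 j) /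
        ((Real.sqrt (monomialNormSq d x₀ F ((m : ℤ) - (d + 2)) ν).toReal : ℝ) : ℂ))‖ₑ ^ 2 =
      ∑' ν, ‖∏ j, z j ^ ν j‖ₑ ^ 2 * (monomialNormSq d x₀ F ((m : ℤ) - (d + 2)) ν)⁻¹ := by
  rw [← tsum_subtype_eq_of_support_subset
    (s := {ν | monomialNormSq d x₀ F ((m : ℤ) - (d + 2)) ν ≠ ⊤})]
  · refine tsum_congr fun ν => ?_
    have hν := ν.2
    have hpos := ENNReal.toReal_pos (h0 ν) hν
    rw [← ofReal_norm, ← ofReal_norm, ← ENNReal.ofReal_pow (norm_nonneg _),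
      ← ENNReal.ofReal_pow (norm_nonneg _), norm_star, norm_div, Complex.norm_real,
      Real.norm_of_nonneg (Real.sqrt_nonneg _), div_pow, Real.sq_sqrt hpos.le, div_eq_mul_inv,
      ENNReal.ofReal_mul (by positivity), ENNReal.ofReal_inv_of_pos hpos, ENNReal.ofReal_toReal hν]
  · intro ν hν htop
    exact hν (by simp only [htop]; simp)

/-- The reproducing kernel on the diagonal, computed in an arbitrary orthonormal basis. -/
theorem hasSum_norm_sq_of_isOrthonormalBasis {m : ℕ}
    (h0 : ∀ ν, monomialNormSq d x₀ F ((m : ℤ) - (d + 2)) ν ≠ 0) (z : domain d x₀ F)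
    (hK : ∑' ν, ‖∏ j, z.1 j ^ ν j‖ₑ ^ 2 * (monomialNormSq d x₀ F ((m : ℤ) - (d + 2)) ν)⁻¹ ≠ ⊤)
    {ι : Type*} {f : ι → weightedSpace (domain d x₀ F) (potential d F) m}
    (hf : IsOrthonormalBasis f) :
    HasSum (fun j => ‖(f j : domain d x₀ F → ℂ) z‖ ^ 2)
      (∑' ν, ‖∏ j, z.1 j ^ ν j‖ₑ ^ 2 *
        (monomialNormSq d x₀ F ((m : ℤ) - (d + 2)) ν)⁻¹).toReal := by
  obtain ⟨w, hw, hw0⟩ := hF.exists_mem_domain_ne_zero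
  rw [← tsum_enorm_sq_kernelVector h0] at hK ⊢
  obtain ⟨κ, hκ⟩ : ∃ κ : lp (fun _ : {ν // monomialNormSq d x₀ F ((m : ℤ) - (d + 2)) ν ≠ ⊤} => ℂ) 2,
      ∀ ν, κ ν = star ((∏ j, z.1 j ^ ν.1 j) /
        ((Real.sqrt (monomialNormSq d x₀ F ((m : ℤ) - (d + 2)) ν).toReal : ℝ) : ℂ)) :=
    ⟨⟨_, memℓp_two_of_tsum_ne_top hK⟩, fun ν => rfl⟩
  have key := hasSum_norm_sq_inner_of_map_eq_single (τ := toL2Linear _ _ m)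
    (hF.norm_coeffMap hw hw0 m) (hF.coeffMap_monomialBasis hw hw0 h0) hf.orthonormal hf.dense κ
  simp only [lp_norm_sq_eq_toReal_tsum, hκ] at key
  exact key.congr_fun fun j => by rw [hF.inner_coeffMap hw hw0 h0 z κ hκ]

end IsKahlerProfile

end Hartogs

/-- The Hartogs domain lies in `ℂⁿ` with `n = d + 1 ≥ 2`. -/
theorem lemma3 (d : ℕ) (hd : 1 ≤ d) (x₀ : EReal) (hx₀ : 0 < x₀) (F : ℝ → ℝ)
    (hF_pos : ∀ t : ℝ, 0 ≤ t → (t : EReal) < x₀ → 0 < F t)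
    (hF_anti : AntitoneOn F {t : ℝ | 0 ≤ t ∧ (t : EReal) < x₀})
    (hF_cont : ContinuousOn F {t : ℝ | 0 ≤ t ∧ (t : EReal) < x₀})
    (hF_smooth : ContDiffOn ℝ ∞ F {t : ℝ | 0 < t ∧ (t : EReal) < x₀})
    (hF_kahler : Hartogs.IsKahlerPotentialOn (Hartogs.potential d F) (Hartogs.domain d x₀ F))
    (γ : ℝ) (hγ : ∀ m : ℕ, 1 ≤ m → Hartogs.SumCondition x₀ F γ m)
    (m : ℕ) (hm : 1 ≤ m) :
    (Hartogs.weightedSpace (Hartogs.domain d x₀ F) (Hartogs.potential d F) m ≠ ⊥ ↔ d + 1 < m) ∧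
    (d + 1 < m →
      (∃ f : ℕ → Hartogs.weightedSpace (Hartogs.domain d x₀ F) (Hartogs.potential d F) m,
        Hartogs.IsOrthonormalBasis f) ∧
      ∀ (ι : Type*)
        (f : ι → Hartogs.weightedSpace (Hartogs.domain d x₀ F) (Hartogs.potential d F) m),
        Hartogs.IsOrthonormalBasis f →
        ∀ z : Hartogs.domain d x₀ F,
          HasSum (fun j => ‖(f j : Hartogs.domain d x₀ F → ℂ) z‖ ^ 2)
            ((∏ l ∈ Finset.Icc 2 (d + 1), ((m : ℝ) - l)) /
                (Real.pi ^ (d + 1) *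
                  (F (‖z.1 0‖ ^ 2) - Hartogs.tailSq z.1) ^ m) *
              ((m : ℝ) - 1 + (1 - Hartogs.tailSq z.1 / F (‖z.1 0‖ ^ 2)) * γ))) := by
  have hF : Hartogs.IsKahlerProfile d x₀ F :=
    ⟨hx₀, hF_pos, hF_anti, hF_cont, hF_smooth, hF_kahler⟩
  obtain ⟨d, rfl⟩ : ∃ e, d = e + 1 := ⟨d - 1, by omega⟩
  have hlarge : d + 1 + 1 < m → ∃ q : ℕ, m = q + (d + 1) + 2 := fun h => ⟨m - (d + 3), by omega⟩
  have hexp : ∀ q : ℕ, ((q + (d + 1) + 2 : ℕ) : ℤ) - (((d + 1 : ℕ) : ℤ) + 2) = (q : ℤ) :=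
    fun q => by push_cast; ring
  have hJ : ∀ q : ℕ, Infinite {ν : Fin (d + 1 + 1) → ℕ // Hartogs.monomialNormSq (d + 1) x₀ F
      (((q + (d + 1) + 2 : ℕ) : ℤ) - (((d + 1 : ℕ) : ℤ) + 2)) ν ≠ ⊤} := fun q => by
    rw [hexp]
    exact (Hartogs.IsKahlerProfile.infinite_monomialNormSq_ne_top hF hγ q).to_subtype
  have h0 : ∀ (q : ℕ) (ν : Fin (d + 1 + 1) → ℕ), Hartogs.monomialNormSq (d + 1) x₀ F
      (((q + (d + 1) + 2 : ℕ) : ℤ) - (((d + 1 : ℕ) : ℤ) + 2)) ν ≠ 0 := fun q ν => by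
    rw [hexp]
    exact hF.monomialNormSq_natCast_ne_zero q ν
  refine ⟨⟨fun hne => ?_, fun hlt hbot => ?_⟩, fun hlt => ⟨?_, fun ι f hf z => ?_⟩⟩
  · by_contra hle
    exact hne (hF.weightedSpace_eq_bot fun ν =>
      Hartogs.IsKahlerProfile.monomialNormSq_eq_top hF (by push_cast; omega) ν)
  · obtain ⟨q, rfl⟩ := hlarge hlt
    obtain ⟨ν⟩ := (hJ q).nonempty
    have hnorm := (hF.isOrthonormalBasis_monomialBasis (h0 q)).orthonormal.1 ν
    have hzero : hF.monomialBasis (q + (d + 1) + 2) ν = 0 := by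
      ext1
      exact (Submodule.mem_bot ℂ).1 (hbot ▸ (hF.monomialBasis (q + (d + 1) + 2) ν).2)
    simp only [hzero] at hnorm
    have htoL2 := (Hartogs.toL2Linear (Hartogs.domain (d + 1) x₀ F)
      (Hartogs.potential (d + 1) F) (q + (d + 1) + 2)).map_zero
    change Hartogs.toL2 0 = 0 at htoL2
    simp [htoL2] at hnorm
  · obtain ⟨q, rfl⟩ := hlarge hlt
    have := hJ q
    obtain ⟨e⟩ := nonempty_equiv_of_countable (α := ℕ)
      (β := {ν : Fin (d + 1 + 1) → ℕ // Hartogs.monomialNormSq (d + 1) x₀ F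
        (((q + (d + 1) + 2 : ℕ) : ℤ) - (((d + 1 : ℕ) : ℤ) + 2)) ν ≠ ⊤})
    have hb := hF.isOrthonormalBasis_monomialBasis (h0 q)
    refine ⟨fun k => hF.monomialBasis _ (e k), hb.orthonormal.comp e e.injective, fun h => ?_⟩
    have hrange := e.surjective.range_comp fun ν =>
      Hartogs.toL2 (hF.monomialBasis (q + (d + 1) + 2) ν)
    have hd' := hb.dense h
    rw [← hrange] at hd'
    exact hd'
  · obtain ⟨q, rfl⟩ := hlarge hlt
    have hK := hF.tsum_monomial_div_normSq hγ q z.2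
    have hK' := hK
    rw [← hexp q] at hK'
    have key := hF.hasSum_norm_sq_of_isOrthonormalBasis (h0 q) z
      (by rw [hK']; exact ENNReal.ofReal_ne_top) hf
    rw [hK', ENNReal.toReal_ofReal] at key
    · exact key
    · have hFt : 0 < F (‖z.1 0‖ ^ 2) := hF_pos _ (by positivity) z.2.1
      have hgap : 0 < F (‖z.1 0‖ ^ 2) - Hartogs.tailSq z.1 := sub_pos.2 z.2.2
      have htail : 0 ≤ Hartogs.tailSq z.1 := Finset.sum_nonneg fun i _ => by positivity
      have hw0 : 0 ≤ Hartogs.tailSq z.1 / F (‖z.1 0‖ ^ 2) := by positivity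
      have hw1 : Hartogs.tailSq z.1 / F (‖z.1 0‖ ^ 2) < 1 := (div_lt_one hFt).2 z.2.2
      have hprod : 0 ≤ ∏ l ∈ Finset.Icc 2 (d + 1 + 1), (((q + (d + 1) + 2 : ℕ) : ℝ) - l) :=
        Finset.prod_nonneg fun l hl => by
          have hl2 : l ≤ q + (d + 1) + 2 := by
            have := (Finset.mem_Icc.1 hl).2
            omega
          exact sub_nonneg.2 (by exact_mod_cast hl2)
      have hγ0 := hF.sub_one_add_nonneg (hγ (q + (d + 1) + 2) (by omega))
      have hm0 : (0 : ℝ) ≤ ((q + (d + 1) + 2 : ℕ) : ℝ) - 1 := by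
        push_cast
        have : (0 : ℝ) ≤ q := q.cast_nonneg
        have : (0 : ℝ) ≤ d := d.cast_nonneg
        linarith
      refine mul_nonneg (by positivity) ?_
      nlinarith
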